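/- For a real number $t$ let $\|t\|$ be the distance from $t$ to the nearest integer, and for $\mathbf y\in\mathbb R^n$ let $\|\mathbf y\|=\max_i\|y_i\|$; for $\mathbf q\in\mathbb Z^n$ let $|\mathbf q|=\max_i|q_i|$. For $\mathbf x\in\mathbb R^n$ define, with values in $[0,\infty]$, $$\omega_0(\mathbf x,\boldsymbol\theta)=\sup\{w\in\mathbb R:\ \|q\mathbf x+\boldsymbol\theta\|<q^{-w}\text{ for infinitely many } q\in\mathbb N\}\qquad(\boldsymbol\theta\in\mathbb R^n),$$ $$\omega_{n-1}(\mathbf x,\theta)=\sup\{w\in\mathbb R:\ \|\mathbf q\cdot\mathbf x+\theta\|<|\mathbf q|^{-w}\text{ for infinitely many } \mathbf q\in\mathbb Z^n\setminus\{0\}\}\qquad(\theta\in\mathbb R),$$ and $\omega_0(\mathbf x)=\omega_0(\mathbf x,\mathbf 0)$, $\omega_{n-1}(\mathbf x)=\omega_{n-1}(\mathbf x,0)$. Let $\mathcal M$ be a differentiable submanifold of $\mathbb R^n$ of dimension $d\ge 1$, that is, every point of $\mathcal M$ has an open neighbourhood $V$ in $\mathbb R^n$ such that $\mathcal M\cap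 V$ is the image of an open subset of $\mathbb R^d$ under a differentiable map with everywhere injective derivative which is a homeomorphism onto its image. Let $\mu$ be the Riemannian measure on $\mathcal M$, i.e. (up to a constant factor) the $d$-dimensional Hausdorff measure restricted to $\mathcal M$, and for $k\in\{0,n-1\}$ let $$\omega_k(\mathcal M)=\sup\{v\in\mathbb R:\ \mu\{\mathbf x:\ \omega_k(\mathbf x)>v\}>0\}.$$ **Theorem.** For $\mu$-almost every $\mathbf x\in\mathcal M$ one has, for every $\boldsymbol\theta\in\mathbb R^n$, $$\omega_0(\mathbf x,\boldsymbol\theta)\ \ge\ \max\bigl(0,\ 1-(n-1)\,\omega_0(\mathcal M)\bigr),$$ and for $\mu$-almost every $\mathbf x\in\mathcal M$ one has, for every $\theta\in\mathbb R$, $$\omega_{n-1}(\mathbf x,\theta)\ \ge\ \frac{\omega_{n-1}(\mathcal M)}{\omega_{n-1}(\mathcal M)-n+1},$$ where the last quotient is read as its limit $1$ if $\omega_{n-1}(\mathcal M)=\infty$ (and $0\cdot\infty=0$ in the first bound). -/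

import Mathlib

open MeasureTheory

noncomputable section

/-- The sup-norm distance from a point of `ℝⁿ` to a nearest integer point. -/
def distInt {n : ℕ} (y : Fin n → ℝ) : ℝ := ‖fun i => y i - (round (y i) : ℝ)‖

/-- The inhomogeneous simultaneous exponent `ω₀(x, θ)`: the supremum, in the extended reals, of
the real `w` such that `‖q x + θ‖ < q ^ (-w)` for infinitely many positive integers `q`. -/
def simExp {n : ℕ} (x θ : EuclideanSpace ℝ (Fin n)) : EReal :=
  sSup ((fun w : ℝ => (w : EReal)) ''
    {w : ℝ | {q : ℕ | 0 < q ∧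
      distInt (fun i => (q : ℝ) * x i + θ i) < (q : ℝ) ^ (-w)}.Infinite})

/-- The inhomogeneous dual exponent `ω_{n-1}(x, θ)`, with `θ` a real number: the supremum, in the
extended reals, of the real `w` such that `‖q · x + θ‖ < |q| ^ (-w)` for infinitely many nonzero
`q ∈ ℤⁿ`. Here `‖t‖ = |t - round t|`, and `|q|` is the sup norm (the norm of `Fin n → ℤ`). -/
def dualExp {n : ℕ} (x : EuclideanSpace ℝ (Fin n)) (θ : ℝ) : EReal :=
  sSup ((fun w : ℝ => (w : EReal)) ''
    {w : ℝ | {q : Fin n → ℤ | q ≠ 0 ∧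
      |(∑ i, (q i : ℝ) * x i + θ) - (round (∑ i, (q i : ℝ) * x i + θ) : ℝ)|
        < ‖q‖ ^ (-w)}.Infinite})

/-- The simultaneous exponent of a measure: `sup {v | μ {x | ω₀(x) > v} > 0}`, where
`ω₀(x) = ω₀(x, 0)`. -/
def simExpMeasure {n : ℕ} (μ : Measure (EuclideanSpace ℝ (Fin n))) : EReal :=
  sSup ((fun v : ℝ => (v : EReal)) '' {v : ℝ | 0 < μ {x | (v : EReal) < simExp x 0}})

/-- The dual exponent of a measure: `sup {v | μ {x | ω_{n-1}(x) > v} > 0}`, where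
`ω_{n-1}(x) = ω_{n-1}(x, 0)`. -/
def dualExpMeasure {n : ℕ} (μ : Measure (EuclideanSpace ℝ (Fin n))) : EReal :=
  sSup ((fun v : ℝ => (v : EReal)) '' {v : ℝ | 0 < μ {x | (v : EReal) < dualExp x 0}})

/-- `M` is a `d`-dimensional differentiable (embedded) submanifold of `ℝⁿ`: near each of its
points it is the image of an open subset of `ℝᵈ` under a differentiable immersion that is a
homeomorphism onto its image. Continuity of the derivative is not required, so `C^k` submanifolds
are included for every `k ≥ 1`. -/
def IsDiffSubmanifold {n : ℕ} (d : ℕ) (M : Set (EuclideanSpace ℝ (Fin n))) : Prop :=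
  ∀ x ∈ M, ∃ V : Set (EuclideanSpace ℝ (Fin n)), IsOpen V ∧ x ∈ V ∧
    ∃ (U : Set (EuclideanSpace ℝ (Fin d)))
      (f : EuclideanSpace ℝ (Fin d) → EuclideanSpace ℝ (Fin n)),
      IsOpen U ∧ DifferentiableOn ℝ f U ∧ (∀ u ∈ U, Function.Injective (fderiv ℝ f u)) ∧
      Topology.IsEmbedding (U.domRestrict f) ∧ f '' U = M ∩ V

/-- The Riemannian measure of a `d`-dimensional submanifold `M` of `ℝⁿ` (up to a constant factor):
the `d`-dimensional Hausdorff measure restricted to `M`. If `M = f(U)` for a parametrization `f`,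
it has the same null sets as the push-forward by `f` of Lebesgue measure on `U`. -/
def submanifoldMeasure {n : ℕ} (d : ℕ) (M : Set (EuclideanSpace ℝ (Fin n))) :
    Measure (EuclideanSpace ℝ (Fin n)) :=
  (Measure.hausdorffMeasure (d : ℝ)).restrict M

/-- `ω₀(M)`. -/
def simExpManifold {n : ℕ} (d : ℕ) (M : Set (EuclideanSpace ℝ (Fin n))) : EReal :=
  simExpMeasure (submanifoldMeasure d M)

/-- `ω_{n-1}(M)`. -/
def dualExpManifold {n : ℕ} (d : ℕ) (M : Set (EuclideanSpace ℝ (Fin n))) : EReal :=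
  dualExpMeasure (submanifoldMeasure d M)

end

/-! Both bounds hold at every non-rational `x` with `ω_k(x) ≤ ω_k(M)`. Almost every `x` qualifies:
Hausdorff measure of positive dimension has no atoms, and `ω_k(M)` is an essential supremum
(`ae_exists_mul_add_ne_zero`, `ae_le_sSup_of_measure_pos`).

The pointwise statement is a transference between the dual lattices of points `(q, q x + p)` and `(h
- u · x, u)`. If an open box with half-sides `β_j` contains no nonzero point of one lattice, then
every target is within a constant times `1 / β_j`, in each coordinate `j`, of a point of the other
(`exists_latticePoint_sub_le`). So an empty box of height `X` and error `r` solves every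
inhomogeneous problem of the other type with height of order `1 / r` and error of order `1 / X`.
What is needed is a lower bound for `X` by a power of `1 / r`, for arbitrarily large `X`.

The empty box is built from minimal points, so that its closure contains two independent lattice
vectors (`exists_minimal_pair`). Short dual vectors are nearly forced to be orthogonal to both. This
makes the problem one of dimension `card ι - 2` and yields a dual vector with coordinates of order
`κ / β_j`, where `κ ^ (card ι - 2)` is of order `∏ β_j` (`exists_latticePoint_le_of_orthogonal`).
That vector is a good homogeneous approximation to `x`, of the type whose quality is limited by
`ω_k(x)`. Comparing the two gives an inequality between `log X` and `log r`, which Dirichlet's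
theorem simplifies to the stated exponent.

In the dual case a minor of the two vectors is a nonzero integer, whence `2 X r ≥ 1` and the
exponent `1` is available without any bound on `ω_{n-1}(x)`. This covers the infinite case, and also
`n = 1`, where the two problems coincide. -/

/-! ### Transference in Euclidean space -/

/-- Induction on dimension. A multiple of a nearly shortest vector `u` corrects the residue of `φ`
at `u`; the rest is solved in the orthogonal complement of `u`, where the projected group still has
minimum at least `σ / 2`. Working with a homomorphism from an abstract group allows projection
without choosing lattice bases. -/
theorem exists_inner_sub_eq_intCast (d : ℕ) :
    ∀ (E : Type) [NormedAddCommGroup E] [InnerProductSpace ℝ E] [FiniteDimensional ℝ E],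
      Module.finrank ℝ E = d → ∀ (G : Type) [AddCommGroup G] (f : G →+ E) (φ : G →+ ℝ) (ρ : ℝ),
      0 < ρ → (∀ g, ‖f g‖ < ρ → f g = 0 ∧ ∃ m : ℤ, φ g = m) →
      ∃ x : E, ‖x‖ ≤ 3 ^ d / ρ ∧ ∀ g, ∃ m : ℤ, inner ℝ x (f g) - φ g = m := by
  induction d with
  | zero =>
    intro E _ _ _ hE G _ f φ ρ hρ h
    have : Subsingleton E := Module.finrank_zero_iff.1 hE
    refine ⟨0, by simp; positivity, fun g => ?_⟩
    obtain ⟨m, hm⟩ := (h g (by rw [Subsingleton.elim (f g) 0]; simpa using hρ)).2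
    exact ⟨-m, by simp [hm]⟩
  | succ d ih =>
    intro E _ _ _ hE G _ f φ ρ hρ h
    by_cases h0 : ∀ g, f g = 0
    · refine ⟨0, by simp; positivity, fun g => ?_⟩
      obtain ⟨m, hm⟩ := (h g (by rw [h0 g]; simpa using hρ)).2
      exact ⟨-m, by simp [hm]⟩
    push Not at h0
    set S : Set ℝ := {t | ∃ g, f g ≠ 0 ∧ ‖f g‖ = t} with hS
    have hSne : S.Nonempty := by
      obtain ⟨g, hg⟩ := h0
      exact ⟨_, g, hg, rfl⟩
    have hSlb : ∀ t ∈ S, ρ ≤ t := by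
      rintro t ⟨g, hg, rfl⟩
      by_contra hlt
      exact hg (h g (not_le.1 hlt)).1
    set σ := sInf S with hσ
    have hρσ : ρ ≤ σ := le_csInf hSne hSlb
    have hσ0 : 0 < σ := hρ.trans_le hρσ
    have hbd : BddBelow S := ⟨ρ, hSlb⟩
    have hmin : ∀ g, ‖f g‖ < σ → f g = 0 ∧ ∃ m : ℤ, φ g = m := by
      intro g hg
      have h1 : f g = 0 := by
        by_contra hne
        exact absurd (csInf_le hbd ⟨g, hne, rfl⟩) (not_le.2 hg)
      exact ⟨h1, (h g (by rw [h1]; simpa using hρ)).2⟩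
    -- The infimum need not be known to be attained; the slack factor `11 / 10` is absorbed below.
    obtain ⟨_, ⟨g₀, hg₀, rfl⟩, hlt⟩ :=
      exists_lt_of_csInf_lt hSne (show sInf S < 11 / 10 * σ by rw [← hσ]; linarith)
    set u := f g₀ with hu
    have hσu : σ ≤ ‖u‖ := csInf_le hbd ⟨g₀, hg₀, rfl⟩
    have hu0 : 0 < ‖u‖ := hσ0.trans_le hσu
    set K : Submodule ℝ E := (Submodule.span ℝ {u})ᗮ with hK
    have hfr : Module.finrank ℝ K = d := by
      have : Fact (Module.finrank ℝ E = d + 1) := ⟨hE⟩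
      exact Submodule.finrank_orthogonal_span_singleton hg₀
    set t : ℝ := φ g₀ - round (φ g₀) with ht
    have htabs : |t| ≤ 1 / 2 := abs_sub_round _
    set x₁ : E := (t / ‖u‖ ^ 2) • u with hx₁
    have hx₁u : inner ℝ x₁ u = t := by
      rw [hx₁, real_inner_smul_left, real_inner_self_eq_norm_sq]
      field_simp
    have hx₁n : ‖x₁‖ ≤ 1 / (2 * σ) := by
      rw [hx₁, norm_smul, Real.norm_eq_abs, abs_div, abs_of_nonneg (sq_nonneg ‖u‖)]
      have : |t| / ‖u‖ ^ 2 * ‖u‖ = |t| / ‖u‖ := by field_simp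
      rw [this, div_le_div_iff₀ hu0 (by positivity)]
      nlinarith [abs_nonneg t]
    let f' : G →+ K := (K.orthogonalProjectionOnto.toLinearMap.toAddMonoidHom).comp f
    let φ' : G →+ ℝ := φ - ((innerSL ℝ x₁).toLinearMap.toAddMonoidHom).comp f
    have hf' : ∀ g, f' g = K.orthogonalProjectionOnto (f g) := fun g => rfl
    have hφ' : ∀ g, φ' g = φ g - inner ℝ x₁ (f g) := fun g => rfl
    have hdec : ∀ g, f g = (inner ℝ u (f g) / ‖u‖ ^ 2) • u + (f' g : E) := by
      intro g
      have := Submodule.starProjection_add_starProjection_orthogonal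
        (K := Submodule.span ℝ {u}) (f g)
      rw [Submodule.starProjection_singleton] at this
      exact this.symm
    obtain ⟨x', hx'n, hx'⟩ := ih K hfr G f' φ' (σ / 2) (by positivity) (by
      intro g hg
      set c := inner ℝ u (f g) / ‖u‖ ^ 2 with hc
      set k := round c with hk
      have e1 : f (g - k • g₀) = (c - k) • u + (f' g : E) := by
        rw [map_sub, map_zsmul, ← hu]
        nth_rewrite 1 [hdec g]
        rw [← hc, sub_smul, Int.cast_smul_eq_zsmul]
        abel
      have horth : inner ℝ u (f' g : E) = 0 :=
        (Submodule.mem_orthogonal_singleton_iff_inner_right).1 (f' g).2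
      have e2 : ‖f (g - k • g₀)‖ ^ 2 = (c - k) ^ 2 * ‖u‖ ^ 2 + ‖f' g‖ ^ 2 := by
        rw [e1, norm_add_sq_real, real_inner_smul_left, horth, norm_smul, mul_pow,
          Real.norm_eq_abs, sq_abs]
        simp
      have hck : (c - k) ^ 2 ≤ 1 / 4 := by
        have := abs_sub_round c
        rw [← sq_abs]
        nlinarith [abs_nonneg (c - round c)]
      -- Subtracting the nearest multiple of `u` leaves squared norm below `(1/4) (11/10)² σ² + σ²/4
      -- < σ²`.
      have e3 : ‖f (g - k • g₀)‖ < σ := by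
        refine lt_of_pow_lt_pow_left₀ 2 hσ0.le ?_
        rw [e2]
        have a1 : (c - k) ^ 2 * ‖u‖ ^ 2 ≤ 1 / 4 * ‖u‖ ^ 2 := by gcongr
        have a2 : ‖u‖ ^ 2 ≤ (11 / 10 * σ) ^ 2 := by gcongr
        have a3 : ‖f' g‖ ^ 2 ≤ (σ / 2) ^ 2 := by gcongr
        nlinarith [pow_pos hσ0 2]
      obtain ⟨e4, m, hm⟩ := hmin _ e3
      have e5 : f g = k • u := by
        rw [map_sub, map_zsmul, sub_eq_zero] at e4
        exact e4
      have e6 : f' g = 0 := by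
        rw [← norm_eq_zero, ← sq_eq_zero_iff]
        rw [e4, norm_zero] at e2
        nlinarith [sq_nonneg ‖f' g‖, mul_nonneg (sq_nonneg (c - k)) (sq_nonneg ‖u‖)]
      refine ⟨e6, m + k * round (φ g₀), ?_⟩
      rw [map_sub, map_zsmul, zsmul_eq_mul] at hm
      rw [hφ', e5, ← Int.cast_smul_eq_zsmul ℝ, real_inner_smul_right, hx₁u, ht]
      push_cast
      linarith)
    refine ⟨x₁ + x', ?_, fun g => ?_⟩
    · have h1 : (3 : ℝ) ^ (d + 1) / σ ≤ 3 ^ (d + 1) / ρ := by gcongr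
      have h2 : ‖x₁ + (x' : E)‖ ≤ 1 / (2 * σ) + 3 ^ d / (σ / 2) :=
        (norm_add_le _ _).trans (add_le_add hx₁n hx'n)
      have h3 : 1 / (2 * σ) + 3 ^ d / (σ / 2) ≤ (3 : ℝ) ^ (d + 1) / σ := by
        rw [show 1 / (2 * σ) + 3 ^ d / (σ / 2) = (1 / 2 + 2 * 3 ^ d) / σ by field_simp]
        gcongr
        have : (1 : ℝ) ≤ 3 ^ d := one_le_pow₀ (by norm_num)
        rw [pow_succ]
        linarith
      linarith
    · obtain ⟨m, hm⟩ := hx' g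
      refine ⟨m, ?_⟩
      have : inner ℝ (x' : E) (f g) = inner ℝ x' (f' g) := by
        rw [hf', Submodule.inner_orthogonalProjectionOnto_eq_of_mem_left]
      rw [inner_add_left, this, ← hm, hφ']
      ring

/-- The point of the lattice spanned by the columns of `A` with integer coordinates `g`. -/
def latticePoint {ι : Type} [Fintype ι] (A : Matrix ι ι ℝ) (g : ι → ℤ) : ι → ℝ :=
  A.mulVec fun i => (g i : ℝ)

theorem latticePoint_eq_sum {ι : Type} [Fintype ι] (A : Matrix ι ι ℝ) (g : ι → ℤ) :
    latticePoint A g = ∑ i, g i • A.transpose i := by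
  ext j
  simp [latticePoint, Matrix.mulVec, dotProduct, mul_comm]

/-! ### Minkowski's theorem and duality for lattices in coordinate boxes -/

section Lattice

variable {ι : Type} [Fintype ι] [DecidableEq ι]

theorem exists_latticePoint_abs_lt (A : Matrix ι ι ℝ) (hA : |A.det| = 1) (b : ι → ℝ)
    (hb : ∀ j, 0 < b j) (hprod : 1 < ∏ j, b j) :
    ∃ g : ι → ℤ, g ≠ 0 ∧ ∀ j, |latticePoint A g j| < b j := by
  have hdet : A.det ≠ 0 := by
    intro h
    simp [h] at hA
  have hli : LinearIndependent ℝ A.transpose :=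
    Matrix.linearIndependent_rows_of_isUnit (A := A.transpose)
      ((Matrix.isUnit_iff_isUnit_det _).2 (by rw [Matrix.det_transpose]; exact hdet.isUnit))
  have : Nonempty ι := by
    by_contra hne
    rw [not_nonempty_iff] at hne
    simp at hprod
  let e : Module.Basis ι ℝ (ι → ℝ) :=
    basisOfLinearIndependentOfCardEqFinrank hli (by simp)
  have he : ⇑e = A.transpose := coe_basisOfLinearIndependentOfCardEqFinrank _ _
  have hfund := ZSpan.isAddFundamentalDomain' e volume
  have hvol : volume (ZSpan.fundamentalDomain e) = 1 := by
    have h1 : (Matrix.of A.transpose).det = A.det := Matrix.det_transpose A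
    rw [ZSpan.volume_fundamentalDomain, he, h1, hA, ENNReal.ofReal_one]
  set s : Set (ι → ℝ) := Set.pi Set.univ fun j => Set.Ioo (-b j) (b j) with hs
  have hvs : volume s = ENNReal.ofReal (∏ j, (2 * b j)) := by
    rw [hs, Real.volume_pi_Ioo, ENNReal.ofReal_prod_of_nonneg]
    · congr 1
      ext j
      congr 1
      ring
    · intro j _
      have := hb j
      positivity
  have : Countable (Submodule.span ℤ (Set.range e)).toAddSubgroup :=
    inferInstanceAs (Countable (Submodule.span ℤ (Set.range e)))
  obtain ⟨x, hx0, hx⟩ := exists_ne_zero_mem_lattice_of_measure_mul_two_pow_lt_measure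
    (s := s) hfund
    (by
      intro x hx
      simp only [hs, Set.mem_pi, Set.mem_univ, true_imp_iff, Set.mem_Ioo, Pi.neg_apply] at hx ⊢
      intro j
      constructor <;> linarith [(hx j).1, (hx j).2])
    (convex_pi fun j _ => convex_Ioo _ _)
    (by
      rw [hvol, hvs, one_mul, Module.finrank_fintype_fun_eq_card, Finset.prod_mul_distrib,
        Finset.prod_const, Finset.card_univ, ENNReal.ofReal_mul (by positivity),
        ENNReal.ofReal_pow (by norm_num), ENNReal.ofReal_ofNat]
      nth_rewrite 1 [← mul_one (2 ^ Fintype.card ι : ENNReal)]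
      have h1 : (1 : ENNReal) < ENNReal.ofReal (∏ j, b j) := by simpa using hprod
      exact (ENNReal.mul_lt_mul_iff_right (by positivity) (by finiteness)).2 h1)
  obtain ⟨g, hg⟩ := (Submodule.mem_span_range_iff_exists_fun ℤ).1 x.2
  have hg : latticePoint A g = x := by
    rw [latticePoint_eq_sum, ← he]
    exact hg
  refine ⟨g, ?_, fun j => ?_⟩
  · rintro rfl
    apply hx0
    ext1
    rw [← hg, latticePoint_eq_sum]
    simp
  · rw [hg, abs_lt]
    exact hx j (Set.mem_univ j)

theorem sum_latticePoint_mul (A B : Matrix ι ι ℝ) (hAB : A.transpose * B = 1) (h g : ι → ℤ) :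
    ∑ j, latticePoint A h j * latticePoint B g j = ((∑ j, h j * g j : ℤ) : ℝ) := by
  have h1 : ∑ j, latticePoint A h j * latticePoint B g j
      = latticePoint A h ⬝ᵥ latticePoint B g := rfl
  rw [h1, latticePoint, latticePoint, Matrix.dotProduct_mulVec, ← Matrix.mulVec_transpose,
    Matrix.mulVec_mulVec, show B.transpose * A = 1 by
      rw [← Matrix.transpose_inj, Matrix.transpose_mul, Matrix.transpose_transpose, hAB,
        Matrix.transpose_one]]
  simp [dotProduct]

/-- After rescaling the box to a cube, the Euclidean transference gives `x` whose pairing with every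
rescaled point of `A` agrees modulo `1` with that of `y`. Then `x / β - y` pairs integrally with the
lattice of `A`, so it lies in the lattice of `B`, and its negative is the required point. -/
theorem exists_latticePoint_sub_le (A B : Matrix ι ι ℝ) (hAB : A.transpose * B = 1)
    (β : ι → ℝ) (hβ : ∀ j, 0 < β j)
    (hmin : ∀ h : ι → ℤ, (∀ j, |latticePoint A h j| < β j) → h = 0) (y : ι → ℝ) :
    ∃ g : ι → ℤ, ∀ j, |latticePoint B g j - y j| ≤ 3 ^ Fintype.card ι / β j := by
  have hadd : ∀ h h' : ι → ℤ, latticePoint A (h + h') = latticePoint A h + latticePoint A h' := by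
    intro h h'
    simp only [latticePoint_eq_sum, Pi.add_apply, add_smul, Finset.sum_add_distrib]
  let f : (ι → ℤ) →+ EuclideanSpace ℝ ι :=
    AddMonoidHom.mk' (fun h => WithLp.toLp 2 fun j => latticePoint A h j / β j) (by
      intro h h'
      ext j
      simp [hadd, add_div])
  let φ : (ι → ℤ) →+ ℝ :=
    AddMonoidHom.mk' (fun h => ∑ j, y j * latticePoint A h j) (by
      intro h h'
      simp [hadd, mul_add, Finset.sum_add_distrib])
  obtain ⟨x, hxn, hx⟩ := exists_inner_sub_eq_intCast (Fintype.card ι) (EuclideanSpace ℝ ι)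
    finrank_euclideanSpace (ι → ℤ) f φ 1 one_pos (by
      intro h hh
      have : h = 0 := hmin h fun j => by
        have h1 : |latticePoint A h j / β j| < 1 := (PiLp.norm_apply_le (f h) j).trans_lt hh
        rwa [abs_div, abs_of_pos (hβ j), div_lt_one (hβ j)] at h1
      subst this
      exact ⟨map_zero f, 0, by simp⟩)
  set w : ι → ℝ := fun j => x j / β j - y j with hw
  have hint : ∀ h, ∃ m : ℤ, ∑ j, w j * latticePoint A h j = m := by
    intro h
    obtain ⟨m, hm⟩ := hx h
    refine ⟨m, ?_⟩
    rw [← hm, PiLp.inner_apply]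
    simp only [f, φ, AddMonoidHom.mk'_apply, ← Finset.sum_sub_distrib]
    refine Finset.sum_congr rfl fun j _ => ?_
    simp [hw]
    ring
  choose k hk using fun i => hint (Pi.single i 1)
  have hcol : ∀ i, latticePoint A (Pi.single i 1) = A.transpose i := by
    intro i
    rw [latticePoint_eq_sum, Finset.sum_eq_single i]
    · simp
    · intro j _ hj
      simp [hj]
    · simp
  have hBk : latticePoint B k = w := by
    have h1 : (fun i => (k i : ℝ)) = A.transpose.mulVec w := by
      ext i
      rw [← hk i, hcol]
      simp [Matrix.mulVec, dotProduct, mul_comm]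
    rw [latticePoint, h1, Matrix.mulVec_mulVec, mul_eq_one_comm.1 hAB, Matrix.one_mulVec]
  refine ⟨-k, fun j => ?_⟩
  have hneg : latticePoint B (-k) j = -w j := by
    rw [← hBk, latticePoint_eq_sum, latticePoint_eq_sum]
    simp
  have h2 : latticePoint B (-k) j - y j = -(x j / β j) := by
    rw [hneg, hw]
    ring
  rw [h2, abs_neg, abs_div, abs_of_pos (hβ j)]
  gcongr
  · exact (hβ j).le
  · exact (PiLp.norm_apply_le x j).trans (by simpa using hxn)

/-- Minkowski is applied to a box that is wide in two coordinates. The resulting vector pairs with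
`z` and `z'` to integers smaller than `1`, hence to `0`, and these two equations control the wide
coordinates by the others. -/
theorem exists_latticePoint_le_of_orthogonal (A B : Matrix ι ι ℝ) (hAB : A.transpose * B = 1)
    (hB : |B.det| = 1) (β : ι → ℝ) (hβ : ∀ j, 0 < β j) (hprod : ∏ j, β j ≤ 1)
    (z z' : ι → ℤ) (hz : ∀ j, |latticePoint A z j| ≤ β j) (hz' : ∀ j, |latticePoint A z' j| ≤ β j)
    (hminor : ∃ i j, latticePoint A z i * latticePoint A z' j
      ≠ latticePoint A z j * latticePoint A z' i)
    (κ : ℝ) (hκ : 0 < κ) (hκprod : 16 * ∏ j, β j < κ ^ (Fintype.card ι - 2)) :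
    ∃ g : ι → ℤ, g ≠ 0 ∧ ∀ j, |latticePoint B g j| ≤ 4 * Fintype.card ι * κ / β j := by
  have hP : 0 < ∏ j, β j := Finset.prod_pos fun j _ => hβ j
  obtain ⟨i₀, j₀, hm₀⟩ := hminor
  have : Nonempty ι := ⟨i₀⟩
  -- If `κ` is not small, the required box has half-sides at least `2 / β j` and plain Minkowski
  -- suffices.
  rcases le_or_gt (1 / 2) (Fintype.card ι * κ) with hbig | hsmall
  · obtain ⟨g, hg, hgb⟩ := exists_latticePoint_abs_lt B hB (fun j => 2 / β j)
      (fun j => div_pos two_pos (hβ j)) (by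
        rw [Finset.prod_div_distrib, lt_div_iff₀ hP, one_mul, Finset.prod_const, Finset.card_univ]
        exact hprod.trans_lt (one_lt_pow₀ one_lt_two Fintype.card_ne_zero))
    refine ⟨g, hg, fun j => (hgb j).le.trans ?_⟩
    have := hβ j
    gcongr
    linarith
  set f : ι → ℝ := fun j => latticePoint A z j / β j with hf
  set f' : ι → ℝ := fun j => latticePoint A z' j / β j with hf'
  have hf1 : ∀ j, |f j| ≤ 1 := fun j => by
    rw [hf, abs_div, abs_of_pos (hβ j), div_le_one (hβ j)]
    exact hz j
  have hf1' : ∀ j, |f' j| ≤ 1 := fun j => by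
    rw [hf', abs_div, abs_of_pos (hβ j), div_le_one (hβ j)]
    exact hz' j
  set M : ι × ι → ℝ := fun p => f p.1 * f' p.2 - f p.2 * f' p.1 with hM
  obtain ⟨⟨i, j⟩, hmax⟩ := Finite.exists_max fun p => |M p|
  have hMpos : 0 < |M (i, j)| := by
    refine lt_of_lt_of_le ?_ (hmax (i₀, j₀))
    rw [abs_pos]
    intro h0
    apply hm₀
    have h1 := (hβ i₀).ne'
    have h2 := (hβ j₀).ne'
    simp only [hM, hf, hf'] at h0
    field_simp at h0
    linarith
  have hij : i ≠ j := by
    rintro rfl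
    simp [hM] at hMpos
  -- The wide coordinates are those of a maximal minor, so that Cramer's rule has coefficients at
  -- most `1`. Two sides `1 / 4` contribute less than `1 / 2` to a pairing and cost the factor `16`.
  set s : ι → ℝ := fun l => if l = i ∨ l = j then 1 / 4 else κ with hs
  have hspos : ∀ l, 0 < s l := by
    intro l
    simp only [hs]
    split_ifs <;> positivity
  have hpair : ({i, j} : Finset ι).card = 2 := Finset.card_pair hij
  have hsprod : ∏ l, s l = 1 / 16 * κ ^ (Fintype.card ι - 2) := by
    rw [← Finset.prod_mul_prod_compl ({i, j} : Finset ι)]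
    congr 1
    · rw [Finset.prod_pair hij]
      simp [hs]
      norm_num
    · rw [Finset.prod_congr rfl (g := fun _ => κ), Finset.prod_const, Finset.card_compl, hpair]
      intro l hl
      have : ¬(l = i ∨ l = j) := by simpa using hl
      simp [hs, this]
  obtain ⟨g, hg, hgb⟩ := exists_latticePoint_abs_lt B hB (fun l => s l / β l)
    (fun l => div_pos (hspos l) (hβ l)) (by
      rw [Finset.prod_div_distrib, lt_div_iff₀ hP, one_mul, hsprod]
      linarith)
  set a : ι → ℝ := fun l => latticePoint B g l * β l with ha
  have has : ∀ l, |a l| < s l := by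
    intro l
    rw [ha, abs_mul, abs_of_pos (hβ l), ← lt_div_iff₀ (hβ l)]
    exact hgb l
  set R : ℝ := ∑ l ∈ ({i, j} : Finset ι)ᶜ, |a l| with hR
  have hRκ : R ≤ Fintype.card ι * κ := by
    calc R ≤ ∑ l ∈ ({i, j} : Finset ι)ᶜ, κ := by
          refine Finset.sum_le_sum fun l hl => ?_
          have : ¬(l = i ∨ l = j) := by simpa using hl
          have h1 := has l
          simp only [hs, this, if_false] at h1
          exact h1.le
      _ ≤ ∑ l : ι, κ := Finset.sum_le_sum_of_subset_of_nonneg (Finset.subset_univ _)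
          fun _ _ _ => hκ.le
      _ = Fintype.card ι * κ := by simp
  have hsum : ∀ c : ι → ℝ, ∑ l, c l = c i + c j + ∑ l ∈ ({i, j} : Finset ι)ᶜ, c l := by
    intro c
    rw [← Finset.sum_add_sum_compl ({i, j} : Finset ι), Finset.sum_pair hij]
  have hzero : ∀ (h : ι → ℤ), (∀ l, |latticePoint A h l / β l| ≤ 1) →
      ∑ l, latticePoint A h l / β l * a l = 0 := by
    intro h hh
    have e1 : ∑ l, latticePoint A h l / β l * a l = ((∑ l, h l * g l : ℤ) : ℝ) := by
      rw [← sum_latticePoint_mul A B hAB]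
      refine Finset.sum_congr rfl fun l _ => ?_
      have := (hβ l).ne'
      simp only [ha]
      field_simp
    have e2 : |∑ l, latticePoint A h l / β l * a l| < 1 := by
      calc |∑ l, latticePoint A h l / β l * a l| ≤ ∑ l, |a l| := by
            refine (Finset.abs_sum_le_sum_abs _ _).trans (Finset.sum_le_sum fun l _ => ?_)
            rw [abs_mul]
            exact mul_le_of_le_one_left (abs_nonneg _) (hh l)
        _ = |a i| + |a j| + R := hsum _
        _ < 1 := by
            have h1 := has i
            have h2 := has j
            simp only [hs, true_or, or_true, if_true] at h1 h2
            linarith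
    rw [e1] at e2 ⊢
    have e3 : |∑ l, h l * g l| < 1 := by exact_mod_cast e2
    rw [Int.abs_lt_one_iff.1 e3]
    simp
  have hz0 : ∑ l, f l * a l = 0 := hzero z hf1
  have hz0' : ∑ l, f' l * a l = 0 := hzero z' hf1'
  have hlin : ∀ p, ∑ l, M (l, p) * a l = 0 := by
    intro p
    have e1 : ∑ l, M (l, p) * a l = f' p * ∑ l, f l * a l - f p * ∑ l, f' l * a l := by
      rw [Finset.mul_sum, Finset.mul_sum, ← Finset.sum_sub_distrib]
      refine Finset.sum_congr rfl fun l _ => ?_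
      simp only [hM]
      ring
    rw [e1, hz0, hz0']
    ring
  have hrest : ∀ p, |∑ l ∈ ({i, j} : Finset ι)ᶜ, M (l, p) * a l| ≤ |M (i, j)| * R := by
    intro p
    rw [hR, Finset.mul_sum]
    refine (Finset.abs_sum_le_sum_abs _ _).trans (Finset.sum_le_sum fun l _ => ?_)
    rw [abs_mul]
    exact mul_le_mul_of_nonneg_right (hmax (l, p)) (abs_nonneg _)
  have hai : |a i| ≤ R := by
    have e1 := hlin j
    rw [hsum] at e1
    have e2 : M (j, j) = 0 := by simp [hM]
    have e3 : M (i, j) * a i = -∑ l ∈ ({i, j} : Finset ι)ᶜ, M (l, j) * a l := by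
      rw [e2] at e1
      linarith
    have e4 : |M (i, j)| * |a i| ≤ |M (i, j)| * R := by
      rw [← abs_mul, e3, abs_neg]
      exact hrest j
    exact le_of_mul_le_mul_left e4 hMpos
  have haj : |a j| ≤ R := by
    have e1 := hlin i
    rw [hsum] at e1
    have e2 : M (i, i) = 0 := by simp [hM]
    have e3 : M (j, i) = -M (i, j) := by
      simp only [hM]
      ring
    have e4 : M (i, j) * a j = ∑ l ∈ ({i, j} : Finset ι)ᶜ, M (l, i) * a l := by
      rw [e2, e3] at e1
      linarith
    have e5 : |M (i, j)| * |a j| ≤ |M (i, j)| * R := by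
      rw [← abs_mul, e4]
      exact hrest i
    exact le_of_mul_le_mul_left e5 hMpos
  refine ⟨g, hg, fun l => ?_⟩
  rw [le_div_iff₀ (hβ l)]
  have hal : |latticePoint B g l| * β l = |a l| := by
    rw [ha, abs_mul, abs_of_pos (hβ l)]
  have hcard : (1 : ℝ) ≤ Fintype.card ι := by exact_mod_cast Fintype.card_pos
  rw [hal]
  rcases eq_or_ne l i with rfl | hli
  · nlinarith
  rcases eq_or_ne l j with rfl | hlj
  · nlinarith
  have h1 := has l
  simp only [hs, hli, hlj, or_self, if_false] at h1
  nlinarith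

end Lattice

/-! ### Minimal points and empty boxes -/

section MinimalPoints

variable {ι : Type} [Fintype ι] [DecidableEq ι]

theorem finite_latticePoint_abs_le (A B : Matrix ι ι ℝ) (hAB : A.transpose * B = 1) (C : ℝ) :
    {g : ι → ℤ | ∀ j, |latticePoint A g j| ≤ C}.Finite := by
  set K : ℝ := ∑ i, ∑ j, |C| * |latticePoint B (Pi.single i 1) j| with hK
  refine (Set.finite_Icc (fun _ : ι => -⌈K⌉) (fun _ : ι => ⌈K⌉)).subset fun g hg => ?_
  have hgi : ∀ i, |g i| ≤ ⌈K⌉ := by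
    intro i
    have h1 : ((g i : ℤ) : ℝ) = ∑ j, latticePoint A g j * latticePoint B (Pi.single i 1) j := by
      rw [sum_latticePoint_mul A B hAB]
      simp [Pi.single_apply]
    have h2 : |(g i : ℝ)| ≤ K := by
      rw [h1]
      refine (Finset.abs_sum_le_sum_abs _ _).trans ?_
      refine le_trans ?_ (Finset.single_le_sum
        (f := fun i => ∑ j, |C| * |latticePoint B (Pi.single i 1) j|)
        (fun i _ => Finset.sum_nonneg fun j _ => by positivity) (Finset.mem_univ i))
      refine Finset.sum_le_sum fun j _ => ?_
      rw [abs_mul]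
      exact mul_le_mul_of_nonneg_right ((hg j).trans (le_abs_self C)) (abs_nonneg _)
    have h3 : (|g i| : ℝ) ≤ ⌈K⌉ := h2.trans (Int.le_ceil K)
    exact_mod_cast h3
  exact ⟨fun i => (abs_le.1 (hgi i)).1, fun i => (abs_le.1 (hgi i)).2⟩

theorem prod_ite_mem_eq_pow (J : Finset ι) (a b : ℝ) :
    ∏ j, (if j ∈ J then a else b) = a ^ J.card * b ^ Jᶜ.card := by
  rw [← Finset.prod_mul_prod_compl J]
  congr 1
  · rw [Finset.prod_congr rfl (g := fun _ => a) fun j hj => by simp [hj], Finset.prod_const]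
  · rw [Finset.prod_congr rfl (g := fun _ => b) fun j hj => by simp [Finset.mem_compl.1 hj],
      Finset.prod_const]

/-- Here `H` is the height and `τ` the error of a lattice point. The pair `z`, `z'` plays the role
of consecutive minimal points: `X` is the height of the later one and `r` the error of the earlier
one. `hpos` keeps errors positive, so there is always a next minimal point. -/
theorem exists_minimal_pair (A B : Matrix ι ι ℝ) (hAB : A.transpose * B = 1) (hA : |A.det| = 1)
    (J : Finset ι) (hJ : J.Nonempty)
    (hpos : ∀ g : ι → ℤ, g ≠ 0 → ∃ j ∉ J, latticePoint A g j ≠ 0) (X₀ : ℝ) :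
    ∃ X r : ℝ, X₀ ≤ X ∧ 0 < X ∧ 0 < r ∧ r ≤ 1 ∧
      (∀ h : ι → ℤ, (∀ j, |latticePoint A h j| < if j ∈ J then X else r) → h = 0) ∧
      ∃ z z' : ι → ℤ, (∀ j, |latticePoint A z j| ≤ if j ∈ J then X else r) ∧
        (∀ j, |latticePoint A z' j| ≤ if j ∈ J then X else r) ∧
        ∃ i ∉ J, ∃ j ∈ J, latticePoint A z i * latticePoint A z' j
          ≠ latticePoint A z j * latticePoint A z' i := by
  let H : (ι → ℤ) → ℝ := fun g => ‖fun j : {j // j ∈ J} => latticePoint A g j‖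
  let τ : (ι → ℤ) → ℝ := fun g => ‖fun j : {j // j ∉ J} => latticePoint A g j‖
  have hH : ∀ g c, 0 ≤ c → (H g ≤ c ↔ ∀ j ∈ J, |latticePoint A g j| ≤ c) := by
    intro g c hc
    simp [H, pi_norm_le_iff_of_nonneg hc]
  have hτ : ∀ g c, 0 ≤ c → (τ g ≤ c ↔ ∀ j ∉ J, |latticePoint A g j| ≤ c) := by
    intro g c hc
    simp [τ, pi_norm_le_iff_of_nonneg hc]
  have hH' : ∀ g c, 0 < c → (H g < c ↔ ∀ j ∈ J, |latticePoint A g j| < c) := by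
    intro g c hc
    simp [H, pi_norm_lt_iff hc]
  have hτ' : ∀ g c, 0 < c → (τ g < c ↔ ∀ j ∉ J, |latticePoint A g j| < c) := by
    intro g c hc
    simp [τ, pi_norm_lt_iff hc]
  have hH0 : ∀ g, 0 ≤ H g := fun g => norm_nonneg _
  have hτ0 : ∀ g, 0 ≤ τ g := fun g => norm_nonneg _
  have hτpos : ∀ g, g ≠ 0 → 0 < τ g := by
    intro g hg
    obtain ⟨j, hj, hne⟩ := hpos g hg
    exact (abs_pos.2 hne).trans_le ((hτ g _ (hτ0 g)).1 le_rfl j hj)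
  have hfin : ∀ c, {g | H g ≤ c ∧ τ g ≤ 1}.Finite := by
    intro c
    refine (finite_latticePoint_abs_le A B hAB (max c 1)).subset ?_
    rintro g ⟨h1, h2⟩ j
    by_cases hj : j ∈ J
    · exact ((hH g c ((hH0 g).trans h1)).1 h1 j hj).trans (le_max_left _ _)
    · exact ((hτ g 1 zero_le_one).1 h2 j hj).trans (le_max_right _ _)
  have hmink : ∀ c ε : ℝ, 0 < c → 0 < ε → 1 < c ^ J.card * ε ^ Jᶜ.card →
      ∃ g ≠ 0, H g < c ∧ τ g < ε := by
    intro c ε hc hε h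
    obtain ⟨g, hg, hgb⟩ := exists_latticePoint_abs_lt A hA (fun j => if j ∈ J then c else ε)
      (fun j => by split_ifs <;> assumption) (by rwa [prod_ite_mem_eq_pow])
    refine ⟨g, hg, (hH' g c hc).2 fun j hj => ?_, (hτ' g ε hε).2 fun j hj => ?_⟩
    · simpa [hj] using hgb j
    · simpa [hj] using hgb j
  have hJ0 : J.card ≠ 0 := hJ.card_pos.ne'
  set X₁ := max X₀ 2 with hX₁
  have hX₁2 : 2 ≤ X₁ := le_max_right _ _
  obtain ⟨g₀, ⟨hg₀0, hg₀H, hg₀τ⟩, hg₀min⟩ := Set.exists_min_image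
    {g | g ≠ 0 ∧ H g ≤ X₁ ∧ τ g ≤ 1} τ ((hfin X₁).subset fun g hg => hg.2) (by
      obtain ⟨g, hg, h1, h2⟩ := hmink X₁ 1 (by linarith) one_pos (by
        rw [one_pow, mul_one]
        exact one_lt_pow₀ (by linarith) hJ0)
      exact ⟨g, hg, h1.le, h2.le⟩)
  have hε : 0 < τ g₀ := hτpos g₀ hg₀0
  obtain ⟨g₁, hg₁0, -, hg₁τ⟩ := hmink (2 / τ g₀ ^ Jᶜ.card) (τ g₀) (by positivity) hε (by
    have hp : 0 < τ g₀ ^ Jᶜ.card := by positivity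
    have h1 : 1 < 2 / τ g₀ ^ Jᶜ.card := by
      rw [lt_div_iff₀ hp]
      linarith [pow_le_one₀ hε.le hg₀τ (n := Jᶜ.card)]
    calc 1 < 2 / τ g₀ ^ Jᶜ.card * τ g₀ ^ Jᶜ.card := by
          rw [div_mul_cancel₀ _ hp.ne']
          norm_num
      _ ≤ _ := by
          gcongr
          exact le_self_pow₀ h1.le hJ0)
  -- The first height at which the error drops below the best one at height `X₁`; hence it exceeds
  -- `X₁`.
  obtain ⟨z', ⟨hz'0, hz'H, hz'τ⟩, hz'min⟩ := Set.exists_min_image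
    {g | g ≠ 0 ∧ H g ≤ H g₁ ∧ τ g < τ g₀} H
    ((hfin (H g₁)).subset fun g hg => ⟨hg.2.1, hg.2.2.le.trans hg₀τ⟩) ⟨g₁, hg₁0, le_rfl, hg₁τ⟩
  have hXX : X₁ < H z' := by
    by_contra hle
    exact absurd (hg₀min z' ⟨hz'0, not_lt.1 hle, hz'τ.le.trans hg₀τ⟩) (not_le.2 hz'τ)
  -- Taking the best error among all heights below that of `z'` makes the open box empty.
  obtain ⟨z, ⟨hz0, hzH, hzτ⟩, hzmin⟩ := Set.exists_min_image
    {g | g ≠ 0 ∧ H g < H z' ∧ τ g ≤ 1} τ ((hfin (H z')).subset fun g hg => ⟨hg.2.1.le, hg.2.2⟩)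
    ⟨g₀, hg₀0, hg₀H.trans_lt hXX, hg₀τ⟩
  have hzz : τ z' < τ z := by
    refine hz'τ.trans_le ?_
    by_contra hlt
    exact absurd (hz'min z ⟨hz0, hzH.le.trans hz'H, not_le.1 hlt⟩) (not_le.2 hzH)
  have hX0 : 0 < H z' := by linarith
  have hr0 : 0 < τ z := hτpos z hz0
  have hle : ∀ g, H g ≤ H z' → τ g ≤ τ z →
      ∀ j, |latticePoint A g j| ≤ if j ∈ J then H z' else τ z := by
    intro g h1 h2 j
    split_ifs with hj
    · exact (hH g _ hX0.le).1 h1 j hj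
    · exact (hτ g _ hr0.le).1 h2 j hj
  refine ⟨H z', τ z, (le_max_left _ _).trans hXX.le, hX0, hr0, hzτ, ?_, z, z',
    hle z hzH.le le_rfl, hle z' le_rfl hzz.le, ?_⟩
  · intro h hh
    by_contra hne
    have h1 : H h < H z' := (hH' h _ hX0).2 fun j hj => by simpa [hj] using hh j
    have h2 : τ h < τ z := (hτ' h _ hr0).2 fun j hj => by simpa [hj] using hh j
    exact absurd (hzmin h ⟨hne, h1, h2.le.trans hzτ⟩) (not_le.2 h2)
  -- Since `z'` has strictly larger height and `z` strictly larger error, one product of the minor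
  -- dominates the other.
  · have h1 := mt (hH z' _ (hH0 z)).2 (not_le.2 hzH)
    have h2 := mt (hτ z _ (hτ0 z')).2 (not_le.2 hzz)
    push Not at h1 h2
    obtain ⟨j, hj, hj'⟩ := h1
    obtain ⟨i, hi, hi'⟩ := h2
    refine ⟨i, hi, j, hj, fun heq => ?_⟩
    have h3 : |latticePoint A z j| ≤ H z := (hH z _ (hH0 z)).1 le_rfl j hj
    have h4 : |latticePoint A z' i| ≤ τ z' := (hτ z' _ (hτ0 z')).1 le_rfl i hi
    have h5 := congrArg abs heq
    rw [abs_mul, abs_mul] at h5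
    have h6 : H z * τ z' < |latticePoint A z' j| * |latticePoint A z i| :=
      mul_lt_mul'' hj' hi' (hH0 z) (hτ0 z')
    have h7 : |latticePoint A z j| * |latticePoint A z' i| ≤ H z * τ z' := by
      gcongr
    linarith [mul_comm |latticePoint A z' j| |latticePoint A z i|]

/-- The transference package: at arbitrarily large heights, the lattice of `B` has a controlled
covering box and, if `card ι > 2`, a short vector. -/
theorem exists_covering_box (A B : Matrix ι ι ℝ) (hAB : A.transpose * B = 1) (hA : |A.det| = 1)
    (J : Finset ι) (hJ : J.Nonempty)
    (hpos : ∀ g : ι → ℤ, g ≠ 0 → ∃ j ∉ J, latticePoint A g j ≠ 0) (X₀ : ℝ) :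
    ∃ X r : ℝ, X₀ ≤ X ∧ 0 < X ∧ 0 < r ∧ X ^ J.card * r ^ Jᶜ.card ≤ 1 ∧
      (∀ y : ι → ℝ, ∃ g : ι → ℤ, ∀ j,
        |latticePoint B g j - y j| ≤ 3 ^ Fintype.card ι / if j ∈ J then X else r) ∧
      (∀ κ : ℝ, 0 < κ → 16 * (X ^ J.card * r ^ Jᶜ.card) < κ ^ (Fintype.card ι - 2) →
        ∃ g : ι → ℤ, g ≠ 0 ∧ ∀ j,
          |latticePoint B g j| ≤ 4 * Fintype.card ι * κ / if j ∈ J then X else r) ∧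
      ∃ z z' : ι → ℤ, (∀ j, |latticePoint A z j| ≤ if j ∈ J then X else r) ∧
        (∀ j, |latticePoint A z' j| ≤ if j ∈ J then X else r) ∧
        ∃ i ∉ J, ∃ j ∈ J, latticePoint A z i * latticePoint A z' j
          ≠ latticePoint A z j * latticePoint A z' i := by
  obtain ⟨X, r, hX₀, hX, hr, -, hmin, z, z', hz, hz', i, hi, j, hj, hij⟩ :=
    exists_minimal_pair A B hAB hA J hJ hpos X₀
  have hβ : ∀ j, 0 < if j ∈ J then X else r := fun j => by split_ifs <;> assumption
  have hB : |B.det| = 1 := by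
    have h1 := congrArg (fun M => |Matrix.det M|) hAB
    simpa [Matrix.det_mul, abs_mul, hA] using h1
  have hprod : X ^ J.card * r ^ Jᶜ.card ≤ 1 := by
    by_contra hlt
    obtain ⟨g, hg, hgb⟩ := exists_latticePoint_abs_lt A hA (fun j => if j ∈ J then X else r) hβ
      (by rw [prod_ite_mem_eq_pow]; exact not_le.1 hlt)
    exact hg (hmin g hgb)
  refine ⟨X, r, hX₀, hX, hr, hprod, exists_latticePoint_sub_le A B hAB _ hβ hmin, ?_,
    z, z', hz, hz', i, hi, j, hj, hij⟩
  intro κ hκ hκp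
  exact exists_latticePoint_le_of_orthogonal A B hAB hB _ hβ
    (by rwa [prod_ite_mem_eq_pow]) z z' hz hz' ⟨i, j, hij⟩ κ hκ (by rwa [prod_ite_mem_eq_pow])

end MinimalPoints

/-! ### From logarithmic inequalities to covering exponents -/

/-- The constants `K` and `C` are absorbed by the loss from `v₁` to `v` once `-log r` is large,
which the relation with `p` guarantees for large `X`. -/
theorem exists_height_bound {K v v₁ C p : ℝ} (hv : v < v₁) (hK : 1 ≤ K) (hp : 0 < p) (N : ℝ) :
    ∃ X₀ : ℝ, 1 ≤ X₀ ∧ ∀ X r : ℝ, X₀ ≤ X → 0 < r → p * Real.log X ≤ -Real.log r →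
      v₁ * (-Real.log r) - C ≤ Real.log X → N ≤ K / r ∧ K / X ≤ (K / r) ^ (-v) := by
  set a₀ := (C + (1 + v) * Real.log K) / (v₁ - v) with ha₀
  set M := max 0 (max a₀ N) with hM
  refine ⟨Real.exp (M / p), Real.one_le_exp (by positivity), fun X r hX hr hpX hb => ?_⟩
  have hX0 : 0 < X := (Real.exp_pos _).trans_le hX
  have hK0 : 0 < K := by linarith
  have h1 : M / p ≤ Real.log X := (Real.le_log_iff_exp_le hX0).2 hX
  have h2 : M ≤ -Real.log r := by
    rw [div_le_iff₀ hp] at h1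
    linarith
  have h3 : N ≤ -Real.log r := (le_max_right _ _).trans ((le_max_right _ _).trans h2)
  have h4 : a₀ ≤ -Real.log r := (le_max_left _ _).trans ((le_max_right _ _).trans h2)
  constructor
  · have h5 : Real.exp (-Real.log r) = 1 / r := by rw [Real.exp_neg, Real.exp_log hr, one_div]
    have h6 := Real.add_one_le_exp (-Real.log r)
    have h7 : 1 / r ≤ K / r := by gcongr
    linarith
  · rw [← Real.log_le_log_iff (by positivity) (by positivity), Real.log_rpow (by positivity),
      Real.log_div hK0.ne' hX0.ne', Real.log_div hK0.ne' hr.ne']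
    rw [ha₀, div_le_iff₀ (by linarith)] at h4
    nlinarith

/-! ### The two dual lattices of `x`, and simultaneous coverings -/

section Matrices

variable {n : ℕ}

/-- The matrix whose lattice consists of the points `(q, q x + p)`. -/
def simMatrix (x : Fin n → ℝ) : Matrix (Unit ⊕ Fin n) (Unit ⊕ Fin n) ℝ :=
  Matrix.fromBlocks 1 0 (Matrix.of fun i _ => x i) 1

/-- The matrix whose lattice consists of the points `(h - u · x, u)`. -/
def dualMatrix (x : Fin n → ℝ) : Matrix (Unit ⊕ Fin n) (Unit ⊕ Fin n) ℝ :=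
  Matrix.fromBlocks 1 (Matrix.of fun _ i => -x i) 0 1

theorem abs_det_simMatrix (x : Fin n → ℝ) : |(simMatrix x).det| = 1 := by
  simp [simMatrix]

theorem abs_det_dualMatrix (x : Fin n → ℝ) : |(dualMatrix x).det| = 1 := by
  simp [dualMatrix]

theorem simMatrix_transpose_mul (x : Fin n → ℝ) : (simMatrix x).transpose * dualMatrix x = 1 := by
  rw [simMatrix, dualMatrix, Matrix.fromBlocks_transpose, Matrix.fromBlocks_multiply,
    ← Matrix.fromBlocks_one]
  congr 1
  · simp
  · ext i j
    simp
  · simp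
  · simp

theorem dualMatrix_transpose_mul (x : Fin n → ℝ) : (dualMatrix x).transpose * simMatrix x = 1 := by
  rw [← Matrix.transpose_inj, Matrix.transpose_mul, Matrix.transpose_transpose,
    simMatrix_transpose_mul, Matrix.transpose_one]

@[simp]
theorem latticePoint_simMatrix_inl (x : Fin n → ℝ) (g : Unit ⊕ Fin n → ℤ) (a : Unit) :
    latticePoint (simMatrix x) g (Sum.inl a) = g (Sum.inl ()) := by
  simp [latticePoint, simMatrix, Matrix.mulVec, dotProduct]

@[simp]
theorem latticePoint_simMatrix_inr (x : Fin n → ℝ) (g : Unit ⊕ Fin n → ℤ) (i : Fin n) :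
    latticePoint (simMatrix x) g (Sum.inr i) = g (Sum.inl ()) * x i + g (Sum.inr i) := by
  simp [latticePoint, simMatrix, Matrix.mulVec, dotProduct, Matrix.one_apply, mul_comm]

@[simp]
theorem latticePoint_dualMatrix_inl (x : Fin n → ℝ) (g : Unit ⊕ Fin n → ℤ) (a : Unit) :
    latticePoint (dualMatrix x) g (Sum.inl a)
      = g (Sum.inl ()) - ∑ i, g (Sum.inr i) * x i := by
  simp [latticePoint, dualMatrix, Matrix.mulVec, dotProduct, mul_comm, sub_eq_add_neg]

@[simp]
theorem latticePoint_dualMatrix_inr (x : Fin n → ℝ) (g : Unit ⊕ Fin n → ℤ) (i : Fin n) :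
    latticePoint (dualMatrix x) g (Sum.inr i) = g (Sum.inr i) := by
  simp [latticePoint, dualMatrix, Matrix.mulVec, dotProduct, Matrix.one_apply]

/-- A lower bound `c |q| ^ (-w)` for the distance of `q x` to the integer points. -/
def SimLowerBound (x : Fin n → ℝ) (c w : ℝ) : Prop :=
  ∀ (q : ℤ) (p : Fin n → ℤ), q ≠ 0 → ∃ i, c * |(q : ℝ)| ^ (-w) ≤ |q * x i + p i|

/-- A lower bound `c |u| ^ (-w)` for the distance of `u · x` to the integers. -/
def DualLowerBound (x : Fin n → ℝ) (c w : ℝ) : Prop :=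
  ∀ (u : Fin n → ℤ) (h : ℤ), u ≠ 0 → c * ‖u‖ ^ (-w) ≤ |h - ∑ i, u i * x i|

/-- For arbitrarily large `T`, every inhomogeneous simultaneous approximation problem is solvable
to within `T ^ (-v)` by a `q` in any given interval of length `2 T`. -/
def SimCovering (x : Fin n → ℝ) (v : ℝ) : Prop :=
  ∀ N : ℝ, ∃ T : ℝ, N ≤ T ∧ ∀ (s : ℝ) (θ : Fin n → ℝ), ∃ (q : ℤ) (p : Fin n → ℤ),
    |q - s| ≤ T ∧ ∀ i, |q * x i + p i - θ i| ≤ T ^ (-v)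

/-- For arbitrarily large `T`, every inhomogeneous dual approximation problem is solvable
to within `T ^ (-v)` by a `u` in any given cube of side `2 T`. -/
def DualCovering (x : Fin n → ℝ) (v : ℝ) : Prop :=
  ∀ N : ℝ, ∃ T : ℝ, N ≤ T ∧ ∀ (s : Fin n → ℝ) (θ : ℝ), ∃ (u : Fin n → ℤ) (h : ℤ),
    (∀ i, |u i - s i| ≤ T) ∧ |h - ∑ i, u i * x i - θ| ≤ T ^ (-v)

theorem log_le_of_lowerBound {c w μ κ X r a : ℝ} (hc : 0 < c) (hw : 0 ≤ w) (hμ : 0 < μ)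
    (hκ : 0 < κ) (hX : 0 < X) (hr : 0 < r) (ha : 0 < a) (har : a ≤ μ * κ / r)
    (h : c * a ^ (-w) ≤ μ * κ / X) :
    Real.log c - w * (Real.log μ + Real.log κ - Real.log r)
      ≤ Real.log μ + Real.log κ - Real.log X := by
  have h1 : c * (μ * κ / r) ^ (-w) ≤ μ * κ / X := by
    refine le_trans ?_ h
    gcongr c * ?_
    exact Real.rpow_le_rpow_of_nonpos ha har (by linarith)
  have h2 := Real.log_le_log (by positivity) h1
  rw [Real.log_mul hc.ne' (by positivity), Real.log_rpow (by positivity),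
    Real.log_div (by positivity) hX.ne', Real.log_div (by positivity) hr.ne',
    Real.log_mul hμ.ne' hκ.ne'] at h2
  linarith

theorem exists_pow_eq_mul {k : ℕ} (hk : k ≠ 0) {P : ℝ} (hP : 0 < P) (hP1 : P ≤ 1) :
    ∃ κ : ℝ, 0 < κ ∧ κ ≤ 17 ∧ 16 * P < κ ^ k ∧ k * Real.log κ = Real.log 17 + Real.log P := by
  refine ⟨(17 * P) ^ ((k : ℝ)⁻¹), by positivity, ?_, ?_, ?_⟩
  · have h1 : (k : ℝ)⁻¹ ≤ 1 := Nat.cast_inv_le_one k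
    calc (17 * P) ^ ((k : ℝ)⁻¹) ≤ 17 ^ ((k : ℝ)⁻¹) := by
          gcongr
          linarith
      _ ≤ 17 ^ (1 : ℝ) := by
          gcongr
          norm_num
      _ = 17 := Real.rpow_one _
  · rw [Real.rpow_inv_natCast_pow (by positivity) hk]
    linarith
  · have : (k : ℝ) ≠ 0 := by exact_mod_cast hk
    rw [Real.log_rpow (by positivity), Real.log_mul (by norm_num) hP.ne']
    field_simp

/-- The empty box lives in the dual lattice, with `X` bounding `u` and `r` bounding `h - u · x`. The
short vector in the simultaneous lattice is confronted with the lower bound on `‖q x‖`. -/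
theorem simCovering_of_lowerBound (hn : 2 ≤ n) (x : Fin n → ℝ) {c w v : ℝ} (hc : 0 < c)
    (hw : 1 / (n : ℝ) ≤ w) (hx : SimLowerBound x c w)
    (hind : ∀ (u : Fin n → ℤ) (h : ℤ), u ≠ 0 → (h : ℝ) - ∑ i, u i * x i ≠ 0)
    (hv : v < 1 - (n - 1) * w) : SimCovering x v := by
  intro N
  have hn0 : (0 : ℝ) < n := by
    have : 0 < n := by omega
    exact_mod_cast this
  have hn2 : (2 : ℝ) ≤ n := by exact_mod_cast hn
  have hw0 : 0 < w := lt_of_lt_of_le (by positivity) hw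
  have hnw : 1 ≤ n * w := by
    rw [div_le_iff₀ hn0] at hw
    linarith
  set m : ℕ := Fintype.card (Unit ⊕ Fin n) with hm
  have hmn : m = n + 1 := by simp [hm, add_comm]
  set μ : ℝ := 4 * m with hμ
  have hμ0 : 0 < μ := by
    have : 0 < m := by omega
    positivity
  set C : ℝ := ((1 + w) * Real.log 17 + (n - 1) * ((1 + w) * Real.log μ - Real.log c))
    / (1 + n * w) with hC
  obtain ⟨X₀, hX₀1, hX₀⟩ := exists_height_bound (K := 3 ^ m) (C := C) hv
    (one_le_pow₀ (by norm_num)) hn0 N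
  set J : Finset (Unit ⊕ Fin n) := {Sum.inl ()}ᶜ with hJ
  have hJmem : ∀ i, Sum.inr i ∈ J := by simp [hJ]
  have hJmem' : Sum.inl () ∉ J := by simp [hJ]
  have hJcard : J.card = n := by simp [hJ, Finset.card_compl, add_comm]
  have hJccard : Jᶜ.card = 1 := by simp [hJ]
  obtain ⟨X, r, hX, hXp, hr, hprod, hcov, hshort, -⟩ := exists_covering_box (dualMatrix x)
    (simMatrix x) (dualMatrix_transpose_mul x) (abs_det_dualMatrix x) J
    ⟨_, hJmem ⟨0, by omega⟩⟩ (by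
      intro g hg
      refine ⟨Sum.inl (), hJmem', ?_⟩
      rw [latticePoint_dualMatrix_inl]
      by_cases hu : (fun i => g (Sum.inr i)) = 0
      · have hu' : ∀ i, g (Sum.inr i) = 0 := fun i => congrFun hu i
        have h0 : g (Sum.inl ()) ≠ 0 := by
          intro h0
          apply hg
          ext j
          rcases j with ⟨⟩ | j
          · exact h0
          · exact hu' j
        simpa [hu'] using h0
      · exact hind _ _ hu) (max X₀ (17 * μ + 1))
  rw [hJcard, hJccard, pow_one] at hprod hshort
  have hX1 : 1 ≤ X := hX₀1.trans ((le_max_left _ _).trans hX)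
  have hXμ : 17 * μ < X := by linarith [(le_max_right _ _).trans hX]
  have hPpos : 0 < X ^ n * r := by positivity
  obtain ⟨κ, hκ, hκ17, hκP, hκlog⟩ := exists_pow_eq_mul (k := m - 2) (by omega) hPpos hprod
  obtain ⟨g, hg, hgb⟩ := hshort κ hκ hκP
  have hlogP : Real.log (X ^ n * r) = n * Real.log X + Real.log r := by
    rw [Real.log_mul (by positivity) hr.ne', Real.log_pow]
  have hb0 : 0 ≤ Real.log X := Real.log_nonneg hX1
  have hnb : n * Real.log X ≤ -Real.log r := by
    have := Real.log_nonpos hPpos.le hprod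
    linarith
  have hgr : |(g (Sum.inl ()) : ℝ)| ≤ μ * κ / r := by
    simpa only [latticePoint_simMatrix_inl, hJmem', if_false] using hgb (Sum.inl ())
  have hgX : ∀ i, |(g (Sum.inl ()) : ℝ) * x i + g (Sum.inr i)| ≤ μ * κ / X := by
    intro i
    simpa only [latticePoint_simMatrix_inr, hJmem i, if_true] using hgb (Sum.inr i)
  -- As `κ ≤ 17` and `X > 17 μ`, a short vector with `q = 0` would have all coordinates zero.
  have hsmall : μ * κ / X < 1 := by
    rw [div_lt_one hXp]
    nlinarith
  have hq : g (Sum.inl ()) ≠ 0 := by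
    intro h0
    apply hg
    ext j
    rcases j with ⟨⟩ | j
    · exact h0
    · have h1 := (hgX j).trans_lt hsmall
      rw [h0] at h1
      simp only [Int.cast_zero, zero_mul, zero_add] at h1
      have h2 : |g (Sum.inr j)| < 1 := by exact_mod_cast h1
      exact Int.abs_lt_one_iff.1 h2
  obtain ⟨i, hi⟩ := hx _ (fun i => g (Sum.inr i)) hq
  have hlog := log_le_of_lowerBound hc hw0.le hμ0 hκ hXp hr (by positivity) hgr (hi.trans (hgX i))
  have hm2 : ((m - 2 : ℕ) : ℝ) = n - 1 := by
    rw [hmn, Nat.cast_sub (by omega)]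
    push_cast
    ring
  rw [hm2, hlogP] at hκlog
  have hden : 0 < 1 + n * w := by positivity
  -- Eliminating `κ` between `hlog` and `hκlog` gives slope `(1 - (n - 2) w) / (1 + n w)`. It is at
  -- least `1 - (n - 1) w` because the cross-multiplied difference is `(n - 1) w (n w - 1)`,
  -- nonnegative by Dirichlet's bound `hw`.
  have hfinal : (1 - (n - 1) * w) * (-Real.log r) - C ≤ Real.log X := by
    rw [hC, sub_le_iff_le_add, ← sub_le_iff_le_add', le_div_iff₀ hden]
    have e1 : (n - 1) * Real.log c - (n - 1) * (w * (Real.log μ + Real.log κ - Real.log r))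
        ≤ (n - 1) * (Real.log μ + Real.log κ - Real.log X) := by
      have := mul_le_mul_of_nonneg_left hlog (show (0 : ℝ) ≤ n - 1 by linarith)
      linarith
    have e2 : 0 ≤ -Real.log r * ((n - 1) * w * (n * w - 1)) := by
      have h1 : 0 ≤ -Real.log r := le_trans (by positivity) hnb
      have h2 : (0 : ℝ) ≤ n - 1 := by linarith
      have h3 : 0 ≤ n * w - 1 := by linarith
      positivity
    have e3 : (1 + w) * ((n - 1) * Real.log κ)
        = (1 + w) * (Real.log 17 + (n * Real.log X + Real.log r)) := by rw [hκlog]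
    linarith
  obtain ⟨hN, hT⟩ := hX₀ X r ((le_max_left _ _).trans hX) hr hnb hfinal
  refine ⟨3 ^ m / r, hN, fun s θ => ?_⟩
  obtain ⟨g, hg⟩ := hcov (Sum.elim (fun _ => s) θ)
  refine ⟨g (Sum.inl ()), fun i => g (Sum.inr i), ?_, fun i => ?_⟩
  · simpa only [latticePoint_simMatrix_inl, hJmem', if_false, Sum.elim_inl] using hg (Sum.inl ())
  · refine le_trans ?_ hT
    simpa only [latticePoint_simMatrix_inr, hJmem i, if_true, Sum.elim_inr] using hg (Sum.inr i)

end Matrices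

/-! ### Dual coverings -/

section DualCovering

variable {n : ℕ}

/-- The empty box now lives in the simultaneous lattice, with `X` bounding `q` and `r` bounding `q x
+ p`. The bound `1 ≤ 2 (X r)` holds because the minor of `z`, `z'` in the coordinate `q` and one
other is a nonzero integer: the terms in `x i` cancel. -/
theorem exists_dualCovering_box (x : Fin n → ℝ)
    (hind : ∀ (q : ℤ) (p : Fin n → ℤ), q ≠ 0 → ∃ i, (q : ℝ) * x i + p i ≠ 0) (X₀ : ℝ) :
    ∃ X r : ℝ, X₀ ≤ X ∧ 0 < X ∧ 0 < r ∧ X * r ^ n ≤ 1 ∧ 1 ≤ 2 * (X * r) ∧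
      (∀ (s : Fin n → ℝ) (θ : ℝ), ∃ (u : Fin n → ℤ) (h : ℤ),
        (∀ i, |u i - s i| ≤ 3 ^ (n + 1) / r) ∧ |h - ∑ i, u i * x i - θ| ≤ 3 ^ (n + 1) / X) ∧
      (∀ κ : ℝ, 0 < κ → 16 * (X * r ^ n) < κ ^ (n - 1) →
        ∃ (u : Fin n → ℤ) (h : ℤ), (u ≠ 0 ∨ h ≠ 0) ∧
          (∀ i, |(u i : ℝ)| ≤ 4 * (n + 1) * κ / r) ∧
          |h - ∑ i, u i * x i| ≤ 4 * (n + 1) * κ / X) := by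
  set J : Finset (Unit ⊕ Fin n) := {Sum.inl ()} with hJ
  have hJmem : Sum.inl () ∈ J := by simp [hJ]
  have hJmem' : ∀ i, Sum.inr i ∉ J := by simp [hJ]
  have hJcard : J.card = 1 := by simp [hJ]
  have hJccard : Jᶜ.card = n := by simp [hJ, Finset.card_compl, add_comm]
  have hm : Fintype.card (Unit ⊕ Fin n) = n + 1 := by simp [add_comm]
  obtain ⟨X, r, hX, hXp, hr, hprod, hcov, hshort, z, z', hz, hz', i, hi, j, hj, hij⟩ :=
    exists_covering_box (simMatrix x) (dualMatrix x) (simMatrix_transpose_mul x)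
    (abs_det_simMatrix x) J ⟨_, hJmem⟩ (by
      intro g hg
      by_cases hq : g (Sum.inl ()) = 0
      · have h1 : ∃ i, g (Sum.inr i) ≠ 0 := by
          by_contra hall
          push Not at hall
          apply hg
          ext j
          rcases j with ⟨⟩ | j
          · exact hq
          · exact hall j
        obtain ⟨i, hi⟩ := h1
        exact ⟨Sum.inr i, hJmem' i, by simpa [hq] using hi⟩
      · obtain ⟨i, hi⟩ := hind _ (fun i => g (Sum.inr i)) hq
        exact ⟨Sum.inr i, hJmem' i, by simpa using hi⟩) X₀
  rw [hJcard, hJccard, pow_one] at hprod hshort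
  rw [hm] at hcov hshort
  refine ⟨X, r, hX, hXp, hr, hprod, ?_, fun s θ => ?_, fun κ hκ hκP => ?_⟩
  · have hj' : j = Sum.inl () := by simpa [hJ] using hj
    subst hj'
    rcases i with ⟨⟩ | i
    · exact absurd hJmem hi
    have b1 : |(z (Sum.inl ()) : ℝ)| ≤ X := by
      simpa only [latticePoint_simMatrix_inl, hJmem, if_true] using hz (Sum.inl ())
    have b2 : |(z' (Sum.inl ()) : ℝ)| ≤ X := by
      simpa only [latticePoint_simMatrix_inl, hJmem, if_true] using hz' (Sum.inl ())
    have b3 : |(z (Sum.inl ()) : ℝ) * x i + z (Sum.inr i)| ≤ r := by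
      simpa only [latticePoint_simMatrix_inr, hi, if_false] using hz (Sum.inr i)
    have b4 : |(z' (Sum.inl ()) : ℝ) * x i + z' (Sum.inr i)| ≤ r := by
      simpa only [latticePoint_simMatrix_inr, hi, if_false] using hz' (Sum.inr i)
    simp only [latticePoint_simMatrix_inl, latticePoint_simMatrix_inr] at hij
    have hint : (z (Sum.inl ()) * x i + z (Sum.inr i)) * z' (Sum.inl ())
        - z (Sum.inl ()) * (z' (Sum.inl ()) * x i + z' (Sum.inr i))
        = ((z (Sum.inr i) * z' (Sum.inl ()) - z (Sum.inl ()) * z' (Sum.inr i) : ℤ) : ℝ) := by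
      push_cast
      ring
    have hne : z (Sum.inr i) * z' (Sum.inl ()) - z (Sum.inl ()) * z' (Sum.inr i) ≠ 0 := by
      intro h0
      rw [h0, Int.cast_zero, sub_eq_zero] at hint
      exact hij hint
    have h1 : (1 : ℝ) ≤ |((z (Sum.inr i) * z' (Sum.inl ())
        - z (Sum.inl ()) * z' (Sum.inr i) : ℤ) : ℝ)| := by
      exact_mod_cast Int.one_le_abs hne
    rw [← hint] at h1
    refine h1.trans ((abs_sub _ _).trans ?_)
    rw [abs_mul, abs_mul]
    have h2 := mul_le_mul b3 b2 (abs_nonneg _) hr.le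
    have h3 := mul_le_mul b1 b4 (abs_nonneg _) hXp.le
    linarith
  · obtain ⟨g, hg⟩ := hcov (Sum.elim (fun _ => θ) s)
    refine ⟨fun i => g (Sum.inr i), g (Sum.inl ()), fun i => ?_, ?_⟩
    · simpa only [latticePoint_dualMatrix_inr, hJmem' i, if_false, Sum.elim_inr]
        using hg (Sum.inr i)
    · simpa only [latticePoint_dualMatrix_inl, hJmem, if_true, Sum.elim_inl] using hg (Sum.inl ())
  · obtain ⟨g, hg, hgb⟩ := hshort κ hκ hκP
    push_cast at hgb
    refine ⟨fun i => g (Sum.inr i), g (Sum.inl ()), ?_, fun i => ?_, ?_⟩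
    · by_contra hall
      push Not at hall
      apply hg
      ext j
      rcases j with ⟨⟩ | j
      · exact hall.2
      · exact congrFun hall.1 j
    · simpa only [latticePoint_dualMatrix_inr, hJmem' i, if_false] using hgb (Sum.inr i)
    · simpa only [latticePoint_dualMatrix_inl, hJmem, if_true] using hgb (Sum.inl ())

theorem dualCovering_of_irrational (hn : n ≠ 0) (x : Fin n → ℝ)
    (hind : ∀ (q : ℤ) (p : Fin n → ℤ), q ≠ 0 → ∃ i, (q : ℝ) * x i + p i ≠ 0) {v : ℝ}
    (hv : v < 1) : DualCovering x v := by
  intro N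
  have hn0 : (0 : ℝ) < n := by exact_mod_cast Nat.pos_of_ne_zero hn
  obtain ⟨X₀, -, hX₀⟩ := exists_height_bound (K := 3 ^ (n + 1)) (C := Real.log 2) hv
    (one_le_pow₀ (by norm_num)) (inv_pos.2 hn0) N
  obtain ⟨X, r, hX, hXp, hr, hprod, hXr, hcov, -⟩ := exists_dualCovering_box x hind X₀
  have h1 : Real.log X + n * Real.log r ≤ 0 := by
    have := Real.log_nonpos (by positivity) hprod
    rwa [Real.log_mul hXp.ne' (by positivity), Real.log_pow] at this
  have h2 : 0 ≤ Real.log 2 + (Real.log X + Real.log r) := by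
    have := Real.log_nonneg hXr
    rwa [Real.log_mul two_ne_zero (by positivity), Real.log_mul hXp.ne' hr.ne'] at this
  obtain ⟨hN, hT⟩ := hX₀ X r hX hr (by rw [inv_mul_le_iff₀ hn0]; linarith) (by linarith)
  refine ⟨_, hN, fun s θ => ?_⟩
  obtain ⟨u, h, hu, hh⟩ := hcov s θ
  exact ⟨u, h, hu, hh.trans hT⟩

theorem dualCovering_of_lowerBound (hn : 2 ≤ n) (x : Fin n → ℝ) {c w v : ℝ} (hc : 0 < c)
    (hw : (n : ℝ) ≤ w) (hx : DualLowerBound x c w)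
    (hind : ∀ (q : ℤ) (p : Fin n → ℤ), q ≠ 0 → ∃ i, (q : ℝ) * x i + p i ≠ 0)
    (hv : v < w / (w - n + 1)) : DualCovering x v := by
  intro N
  have hn2 : (2 : ℝ) ≤ n := by exact_mod_cast hn
  have hn0 : (0 : ℝ) < n := by linarith
  have hw0 : 0 < w := by linarith
  set μ : ℝ := 4 * (n + 1) with hμ
  have hμ0 : 0 < μ := by positivity
  have hden : 0 < w - n + 2 := by linarith
  have hden' : 0 < w - n + 1 := by linarith
  set C : ℝ := ((1 + w) * Real.log 17 + (n - 1) * ((1 + w) * Real.log μ - Real.log c))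
    / (w - n + 2) with hC
  obtain ⟨X₀, hX₀1, hX₀⟩ := exists_height_bound (K := 3 ^ (n + 1)) (C := C) hv
    (one_le_pow₀ (by norm_num)) (inv_pos.2 hn0) N
  obtain ⟨X, r, hX, hXp, hr, hprod, -, hcov, hshort⟩ :=
    exists_dualCovering_box x hind (max X₀ (17 * μ + 1))
  have hX1 : 1 ≤ X := hX₀1.trans ((le_max_left _ _).trans hX)
  have hXμ : 17 * μ < X := by linarith [(le_max_right _ _).trans hX]
  have hPpos : 0 < X * r ^ n := by positivity
  obtain ⟨κ, hκ, hκ17, hκP, hκlog⟩ := exists_pow_eq_mul (k := n - 1) (by omega) hPpos hprod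
  obtain ⟨u, h, huh, hu, hh⟩ := hshort κ hκ hκP
  rw [Real.log_mul hXp.ne' (by positivity), Real.log_pow, Nat.cast_sub (by omega),
    Nat.cast_one] at hκlog
  have hb0 : 0 ≤ Real.log X := Real.log_nonneg hX1
  have hnb : Real.log X + n * Real.log r ≤ 0 := by
    have := Real.log_nonpos (by positivity) hprod
    rwa [Real.log_mul hXp.ne' (by positivity), Real.log_pow] at this
  have ha0 : 0 ≤ -Real.log r := by
    by_contra hlt
    nlinarith
  have hu0 : u ≠ 0 := by
    rintro rfl
    have hsmall : μ * κ / X < 1 := by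
      rw [div_lt_one hXp]
      nlinarith
    have h1 := hh.trans_lt hsmall
    simp only [Pi.zero_apply, Int.cast_zero, zero_mul, Finset.sum_const_zero, sub_zero] at h1
    have h2 : |h| < 1 := by exact_mod_cast h1
    simp [Int.abs_lt_one_iff.1 h2] at huh
  have hunorm : ‖u‖ ≤ μ * κ / r := by
    rw [pi_norm_le_iff_of_nonneg (by positivity)]
    intro i
    rw [Int.norm_eq_abs]
    exact hu i
  have hlog := log_le_of_lowerBound hc hw0.le hμ0 hκ hXp hr (norm_pos_iff.2 hu0) hunorm
    ((hx u h hu0).trans hh)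
  -- Eliminating `κ` gives slope `(n + w) / (w - n + 2)`; cross-multiplied, it exceeds the one
  -- wanted by `(n - 1) (w - n) ≥ 0`.
  have hfinal : w / (w - n + 1) * (-Real.log r) - C ≤ Real.log X := by
    have h0 : w / (w - n + 1) * (-Real.log r) ≤ (n + w) / (w - n + 2) * (-Real.log r) := by
      refine mul_le_mul_of_nonneg_right ?_ ha0
      rw [div_le_div_iff₀ hden' hden]
      nlinarith [mul_nonneg (show (0 : ℝ) ≤ n - 1 by linarith) (sub_nonneg.2 hw)]
    refine (sub_le_sub_right h0 C).trans ?_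
    rw [hC, div_mul_eq_mul_div, ← sub_div, div_le_iff₀ hden]
    have e1 : (n - 1) * Real.log c - (n - 1) * (w * (Real.log μ + Real.log κ - Real.log r))
        ≤ (n - 1) * (Real.log μ + Real.log κ - Real.log X) := by
      have := mul_le_mul_of_nonneg_left hlog (show (0 : ℝ) ≤ n - 1 by linarith)
      linarith
    have e3 : (1 + w) * ((n - 1) * Real.log κ)
        = (1 + w) * (Real.log 17 + (Real.log X + n * Real.log r)) := by rw [hκlog]
    linarith
  obtain ⟨hN, hT⟩ := hX₀ X r ((le_max_left _ _).trans hX) hr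
    (by rw [inv_mul_le_iff₀ hn0]; linarith) hfinal
  refine ⟨_, hN, fun s θ => ?_⟩
  obtain ⟨u, h, hu, hh⟩ := hcov s θ
  exact ⟨u, h, hu, hh.trans hT⟩

theorem simCovering_one_of_irrational (x : Fin 1 → ℝ)
    (hind : ∀ (q : ℤ) (p : Fin 1 → ℤ), q ≠ 0 → ∃ i, (q : ℝ) * x i + p i ≠ 0) {v : ℝ}
    (hv : v < 1) : SimCovering x v := by
  intro N
  obtain ⟨T, hT, hcov⟩ := dualCovering_of_irrational one_ne_zero x hind hv N
  refine ⟨T, hT, fun s θ => ?_⟩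
  obtain ⟨u, h, hu, hh⟩ := hcov (fun _ => s) (-θ 0)
  refine ⟨u 0, fun _ => -h, hu 0, fun i => ?_⟩
  rw [Fin.fin_one_eq_zero i, ← abs_neg]
  convert hh using 2
  simp
  ring

end DualCovering

/-! ### Dirichlet bounds and rational relations -/

section Dirichlet

variable {n : ℕ}

theorem le_of_dualLowerBound (hn : n ≠ 0) (x : Fin n → ℝ) {c w : ℝ} (hc : 0 < c)
    (hx : DualLowerBound x c w) : (n : ℝ) ≤ w := by
  have hn0 : (0 : ℝ) < n := by exact_mod_cast Nat.pos_of_ne_zero hn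
  by_contra hlt
  rw [not_le] at hlt
  -- Truncating at `0` makes `t ↦ t ^ (-w')` antitone, also when `w` is negative.
  set w' := max w 0 with hw'
  have hw'n : 0 < n - w' := by
    rw [sub_pos]
    exact max_lt hlt hn0
  obtain ⟨Q, hQ2, hQ⟩ : ∃ Q : ℝ, 2 < Q ∧ 2 / c < Q ^ (n - w') :=
    ((Filter.eventually_gt_atTop 2).and
      ((tendsto_rpow_atTop hw'n).eventually_gt_atTop (2 / c))).exists
  have hQ0 : 0 < Q := by linarith
  obtain ⟨g, hg, hgb⟩ := exists_latticePoint_abs_lt (dualMatrix x) (abs_det_dualMatrix x)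
    (Sum.elim (fun _ => 2 / Q ^ n) fun _ => Q)
    (by rintro (_ | _) <;> simp <;> positivity)
    (by
      rw [Fintype.prod_sum_type]
      simp only [Sum.elim_inl, Sum.elim_inr, Finset.prod_const, Finset.card_univ,
        Fintype.card_fin, Fintype.card_unit, pow_one]
      rw [div_mul_cancel₀ _ (by positivity)]
      norm_num)
  have h0 : |(g (Sum.inl ()) : ℝ) - ∑ i, g (Sum.inr i) * x i| < 2 / Q ^ n := by
    simpa only [latticePoint_dualMatrix_inl, Sum.elim_inl] using hgb (Sum.inl ())
  have hi : ∀ i, |(g (Sum.inr i) : ℝ)| < Q := by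
    intro i
    simpa only [latticePoint_dualMatrix_inr, Sum.elim_inr] using hgb (Sum.inr i)
  have hu0 : (fun i => g (Sum.inr i)) ≠ 0 := by
    intro hu
    have hu' : ∀ i, g (Sum.inr i) = 0 := fun i => congrFun hu i
    have h1 : 2 / Q ^ n < 1 := by
      rw [div_lt_one (by positivity)]
      exact hQ2.trans_le (le_self_pow₀ (by linarith) hn)
    have h2 := h0.trans h1
    simp only [hu', Int.cast_zero, zero_mul, Finset.sum_const_zero, sub_zero] at h2
    have h3 : |g (Sum.inl ())| < 1 := by exact_mod_cast h2
    apply hg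
    ext j
    rcases j with ⟨⟩ | j
    · exact Int.abs_lt_one_iff.1 h3
    · exact hu' j
  have hunorm : ‖fun i => g (Sum.inr i)‖ ≤ Q := by
    rw [pi_norm_le_iff_of_nonneg hQ0.le]
    intro i
    rw [Int.norm_eq_abs]
    exact (hi i).le
  have hu1 : 1 ≤ ‖fun i => g (Sum.inr i)‖ := by
    obtain ⟨i, hi⟩ := Function.ne_iff.1 hu0
    refine le_trans ?_ (norm_le_pi_norm _ i)
    rw [Int.norm_eq_abs]
    exact_mod_cast Int.one_le_abs hi
  have h1 := hx _ (g (Sum.inl ())) hu0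
  have h2 : Q ^ (-w') ≤ ‖fun i => g (Sum.inr i)‖ ^ (-w) := by
    calc Q ^ (-w') ≤ ‖fun i => g (Sum.inr i)‖ ^ (-w') :=
          Real.rpow_le_rpow_of_nonpos (by linarith) hunorm (by simp [hw'])
      _ ≤ _ := Real.rpow_le_rpow_of_exponent_le hu1 (by simp [hw'])
  have h3 : c * Q ^ (-w') < 2 / Q ^ n :=
    ((mul_le_mul_of_nonneg_left h2 hc.le).trans h1).trans_lt h0
  have h4 : Q ^ (n - w') = Q ^ n * Q ^ (-w') := by
    rw [sub_eq_add_neg, Real.rpow_add hQ0, Real.rpow_natCast]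
  rw [h4, div_lt_iff₀ hc] at hQ
  rw [lt_div_iff₀ (by positivity)] at h3
  linarith

theorem one_div_le_of_simLowerBound (hn : n ≠ 0) (x : Fin n → ℝ) {c w : ℝ} (hc : 0 < c)
    (hx : SimLowerBound x c w) : 1 / (n : ℝ) ≤ w := by
  have hn0 : (0 : ℝ) < n := by exact_mod_cast Nat.pos_of_ne_zero hn
  by_contra hlt
  rw [not_le] at hlt
  set w' := max w 0 with hw'
  have hw'n : 0 < 1 - n * w' := by
    have : w' < 1 / n := max_lt hlt (by positivity)
    rw [lt_div_iff₀ hn0] at this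
    linarith
  obtain ⟨Q, hQ2, hQ⟩ : ∃ Q : ℝ, 2 < Q ∧ 2 ^ w' / c < Q ^ (1 - n * w') :=
    ((Filter.eventually_gt_atTop 2).and
      ((tendsto_rpow_atTop hw'n).eventually_gt_atTop (2 ^ w' / c))).exists
  have hQ0 : 0 < Q := by linarith
  obtain ⟨g, hg, hgb⟩ := exists_latticePoint_abs_lt (simMatrix x) (abs_det_simMatrix x)
    (Sum.elim (fun _ => 2 * Q ^ n) fun _ => 1 / Q)
    (by rintro (_ | _) <;> simp <;> positivity)
    (by
      rw [Fintype.prod_sum_type]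
      simp only [Sum.elim_inl, Sum.elim_inr, Finset.prod_const, Finset.card_univ,
        Fintype.card_fin, Fintype.card_unit, pow_one, div_pow, one_pow]
      rw [mul_one_div, mul_div_cancel_right₀ _ (by positivity)]
      norm_num)
  have h0 : |(g (Sum.inl ()) : ℝ)| < 2 * Q ^ n := by
    simpa only [latticePoint_simMatrix_inl, Sum.elim_inl] using hgb (Sum.inl ())
  have hi : ∀ i, |(g (Sum.inl ()) : ℝ) * x i + g (Sum.inr i)| < 1 / Q := by
    intro i
    simpa only [latticePoint_simMatrix_inr, Sum.elim_inr] using hgb (Sum.inr i)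
  have hq0 : g (Sum.inl ()) ≠ 0 := by
    intro hq
    apply hg
    ext j
    rcases j with ⟨⟩ | j
    · exact hq
    · have h1 : 1 / Q < 1 := by
        rw [div_lt_one hQ0]
        linarith
      have h2 := (hi j).trans h1
      simp only [hq, Int.cast_zero, zero_mul, zero_add] at h2
      have h3 : |g (Sum.inr j)| < 1 := by exact_mod_cast h2
      exact Int.abs_lt_one_iff.1 h3
  have hq1 : (1 : ℝ) ≤ |(g (Sum.inl ()) : ℝ)| := by exact_mod_cast Int.one_le_abs hq0
  obtain ⟨i, h1⟩ := hx _ (fun i => g (Sum.inr i)) hq0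
  have h2 : (2 * Q ^ n) ^ (-w') ≤ |(g (Sum.inl ()) : ℝ)| ^ (-w) := by
    calc (2 * Q ^ n) ^ (-w') ≤ |(g (Sum.inl ()) : ℝ)| ^ (-w') :=
          Real.rpow_le_rpow_of_nonpos (by linarith) h0.le (by simp [hw'])
      _ ≤ _ := Real.rpow_le_rpow_of_exponent_le hq1 (by simp [hw'])
  have h3 : c * (2 * Q ^ n) ^ (-w') < 1 / Q :=
    ((mul_le_mul_of_nonneg_left h2 hc.le).trans h1).trans_lt (hi i)
  have h4 : Q ^ (1 - n * w') = Q * 2 ^ w' * (2 * Q ^ n) ^ (-w') := by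
    rw [sub_eq_add_neg, Real.rpow_add hQ0, Real.rpow_one, Real.mul_rpow two_pos.le (by positivity),
      ← Real.rpow_natCast, ← Real.rpow_mul hQ0.le, mul_neg, mul_assoc, ← mul_assoc (2 ^ w'),
      ← Real.rpow_add two_pos, add_neg_cancel, Real.rpow_zero, one_mul]
  rw [h4, div_lt_iff₀ hc] at hQ
  rw [lt_div_iff₀ hQ0] at h3
  have h5 : (0 : ℝ) < 2 ^ w' := by positivity
  nlinarith

end Dirichlet

/-- A rational relation places `x` on a rational hyperplane, where Dirichlet's exponent improves to
`1 / (n - 1)`. In the main argument this excludes such relations whenever the simultaneous bound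
sought is positive. -/
theorem one_le_mul_of_simLowerBound {n : ℕ} (x : Fin n → ℝ) {c w : ℝ} (hc : 0 < c)
    (hx : SimLowerBound x c w) (u : Fin n → ℤ) (h : ℤ) (hu : u ≠ 0)
    (huh : (h : ℝ) - ∑ i, u i * x i = 0) : 1 ≤ (n - 1) * w := by
  obtain ⟨i₁, hi₁⟩ := Function.ne_iff.1 hu
  have hn : 0 < n := i₁.pos
  have : Nonempty (Fin n) := ⟨i₁⟩
  have hn1 : (1 : ℝ) ≤ n := by exact_mod_cast hn
  obtain ⟨i₀, hi₀⟩ := Finite.exists_max fun i => |(u i : ℝ)|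
  set M : ℝ := |(u i₀ : ℝ)| with hM
  have hM1 : 1 ≤ M := by
    refine le_trans ?_ (hi₀ i₁)
    exact_mod_cast Int.one_le_abs hi₁
  have hM0 : 0 < M := by linarith
  by_contra hlt
  rw [not_le] at hlt
  set w' := max w 0 with hw'
  have hw'n : 0 < 1 - (n - 1) * w' := by
    rcases le_total w 0 with h0 | h0
    · simp [hw', h0]
    · rw [hw', max_eq_left h0]
      linarith
  obtain ⟨Q, hQ2, hQ⟩ : ∃ Q : ℝ, 2 * n * M < Q ∧ n * (8 * M) ^ w' / c < Q ^ (1 - (n - 1) * w') :=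
    ((Filter.eventually_gt_atTop (2 * n * M)).and
      ((tendsto_rpow_atTop hw'n).eventually_gt_atTop (n * (8 * M) ^ w' / c))).exists
  have hQ0 : 0 < Q := lt_trans (by positivity) hQ2
  -- The coordinate with the largest coefficient needs no small bound in advance: `∑ u i * e i` is
  -- an integer less than `1` in absolute value, hence `0`, and this determines `e i₀` from the
  -- others.
  set b : Fin n → ℝ := fun i => if i = i₀ then 1 / (4 * M) else 1 / Q with hb
  have hb0 : ∀ i, 0 < b i := by
    intro i
    simp only [hb]
    split_ifs <;> positivity
  obtain ⟨g, hg, hgb⟩ := exists_latticePoint_abs_lt (simMatrix x) (abs_det_simMatrix x)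
    (Sum.elim (fun _ => 8 * M * Q ^ (n - 1)) b)
    (by
      rintro (_ | i)
      · simp only [Sum.elim_inl]
        positivity
      · exact hb0 i)
    (by
      have hprod : ∏ i, b i = 1 / (4 * M) * (1 / Q) ^ (n - 1) := by
        rw [Fintype.prod_eq_mul_prod_compl i₀]
        congr 1
        · simp [hb]
        · rw [Finset.prod_congr rfl (g := fun _ => 1 / Q), Finset.prod_const, Finset.card_compl]
          · simp
          · intro i hi
            have : i ≠ i₀ := by simpa using hi
            simp [hb, this]
      rw [Fintype.prod_sum_type]
      simp only [Sum.elim_inl, Sum.elim_inr, Finset.prod_const, Finset.card_univ,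
        Fintype.card_unit, pow_one]
      rw [hprod, one_div_pow]
      field_simp
      norm_num)
  set q := g (Sum.inl ()) with hq
  set e : Fin n → ℝ := fun i => (q : ℝ) * x i + g (Sum.inr i) with he
  have h0 : |(q : ℝ)| < 8 * M * Q ^ (n - 1) := by
    simpa only [latticePoint_simMatrix_inl, Sum.elim_inl] using hgb (Sum.inl ())
  have hei : ∀ i, |e i| < b i := by
    intro i
    simpa only [latticePoint_simMatrix_inr, Sum.elim_inr] using hgb (Sum.inr i)
  have hrest : |∑ i ∈ ({i₀} : Finset (Fin n))ᶜ, u i * e i| ≤ M * (n / Q) := by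
    calc |∑ i ∈ ({i₀} : Finset (Fin n))ᶜ, u i * e i|
        ≤ ∑ i ∈ ({i₀} : Finset (Fin n))ᶜ, M * (1 / Q) := by
          refine (Finset.abs_sum_le_sum_abs _ _).trans (Finset.sum_le_sum fun i hi => ?_)
          have hne : i ≠ i₀ := by simpa using hi
          have h1 := hei i
          simp only [hb, hne, if_false] at h1
          rw [abs_mul]
          exact mul_le_mul (hi₀ i) h1.le (abs_nonneg _) hM0.le
      _ ≤ ∑ i : Fin n, M * (1 / Q) := Finset.sum_le_sum_of_subset_of_nonneg
          (Finset.subset_univ _) fun _ _ _ => by positivity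
      _ = M * (n / Q) := by
          simp
          ring
  have hsplit : ∑ i, u i * e i = u i₀ * e i₀ + ∑ i ∈ ({i₀} : Finset (Fin n))ᶜ, u i * e i :=
    Fintype.sum_eq_add_sum_compl i₀ _
  have hnQ : M * (n / Q) < 1 / 2 := by
    rw [mul_div_assoc', div_lt_iff₀ hQ0]
    linarith
  have hzero : ∑ i, u i * e i = 0 := by
    have h1 : ∑ i, u i * e i = ((q * h + ∑ i, u i * g (Sum.inr i) : ℤ) : ℝ) := by
      push_cast
      rw [sub_eq_zero.1 huh, Finset.mul_sum, ← Finset.sum_add_distrib]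
      refine Finset.sum_congr rfl fun i _ => ?_
      simp only [he]
      ring
    have h2 : |∑ i, u i * e i| < 1 := by
      have h3 : |u i₀ * e i₀| ≤ 1 / 4 := by
        have h4 := hei i₀
        simp only [hb, if_true] at h4
        rw [abs_mul]
        calc M * |e i₀| ≤ M * (1 / (4 * M)) := by gcongr
          _ = 1 / 4 := by field_simp
      rw [hsplit]
      linarith [abs_add_le (u i₀ * e i₀) (∑ i ∈ ({i₀} : Finset (Fin n))ᶜ, u i * e i)]
    rw [h1] at h2 ⊢
    have h3 : |q * h + ∑ i, u i * g (Sum.inr i)| < 1 := by exact_mod_cast h2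
    rw [Int.abs_lt_one_iff.1 h3]
    simp
  have hall : ∀ i, |e i| ≤ n / Q := by
    intro i
    by_cases hi : i = i₀
    · subst hi
      rw [hsplit] at hzero
      have h1 : u i * e i = -∑ j ∈ ({i} : Finset (Fin n))ᶜ, u j * e j := by linarith
      have h2 : M * |e i| ≤ M * (n / Q) := by
        rw [hM, ← abs_mul, h1, abs_neg]
        exact hrest
      exact le_of_mul_le_mul_left h2 hM0
    · have h1 := hei i
      simp only [hb, hi, if_false] at h1
      refine h1.le.trans ?_
      gcongr
  have hnQ1 : n / Q < 1 := by
    rw [div_lt_one hQ0]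
    nlinarith
  have hq0 : q ≠ 0 := by
    intro hq0
    apply hg
    ext j
    rcases j with ⟨⟩ | j
    · exact hq0
    · have h2 := (hall j).trans_lt hnQ1
      simp only [he, hq0, Int.cast_zero, zero_mul, zero_add] at h2
      have h3 : |g (Sum.inr j)| < 1 := by exact_mod_cast h2
      exact Int.abs_lt_one_iff.1 h3
  have hq1 : (1 : ℝ) ≤ |(q : ℝ)| := by exact_mod_cast Int.one_le_abs hq0
  obtain ⟨i, h1⟩ := hx _ (fun i => g (Sum.inr i)) hq0
  have h2 : (8 * M * Q ^ (n - 1)) ^ (-w') ≤ |(q : ℝ)| ^ (-w) := by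
    calc (8 * M * Q ^ (n - 1)) ^ (-w') ≤ |(q : ℝ)| ^ (-w') :=
          Real.rpow_le_rpow_of_nonpos (by linarith) h0.le (by simp [hw'])
      _ ≤ _ := Real.rpow_le_rpow_of_exponent_le hq1 (by simp [hw'])
  have h3 : c * (8 * M * Q ^ (n - 1)) ^ (-w') ≤ n / Q :=
    ((mul_le_mul_of_nonneg_left h2 hc.le).trans h1).trans (hall i)
  have h4 : Q ^ (1 - (n - 1) * w') = Q * (8 * M) ^ w' * (8 * M * Q ^ (n - 1)) ^ (-w') := by
    have h5 : Q ^ (n - 1) = Q ^ ((n : ℝ) - 1) := by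
      rw [← Real.rpow_natCast, Nat.cast_sub hn, Nat.cast_one]
    rw [sub_eq_add_neg, Real.rpow_add hQ0, Real.rpow_one,
      Real.mul_rpow (x := 8 * M) (by positivity) (by positivity), h5, ← Real.rpow_mul hQ0.le, mul_neg,
      mul_assoc, ← mul_assoc ((8 * M) ^ w'), ← Real.rpow_add (by positivity), add_neg_cancel,
      Real.rpow_zero, one_mul]
  rw [h4, div_lt_iff₀ hc] at hQ
  rw [le_div_iff₀ hQ0] at h3
  have h5 : (0 : ℝ) < (8 * M) ^ w' := by positivity
  nlinarith

/-! ### Coverings, lower bounds and exponents -/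

section Exponents

variable {n : ℕ}

theorem EReal.coe_le_of_forall_lt {b : ℝ} {E : EReal} (h : ∀ v : ℝ, v < b → (v : EReal) ≤ E) :
    (b : EReal) ≤ E := by
  refine le_of_forall_lt fun a ha => ?_
  obtain ⟨v, hv1, hv2⟩ := EReal.lt_iff_exists_real_btwn.1 ha
  exact hv1.trans_le (h v (by exact_mod_cast hv2))

theorem EReal.coe_le_of_forall_nonneg_lt {b : ℝ} {E : EReal} (hb : 0 < b)
    (h : ∀ v : ℝ, 0 ≤ v → v < b → (v : EReal) ≤ E) : (b : EReal) ≤ E := by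
  refine EReal.coe_le_of_forall_lt fun v hv => ?_
  have h1 : (v : EReal) ≤ (max v 0 : ℝ) := by exact_mod_cast le_max_left v 0
  exact h1.trans (h _ (le_max_right _ _) (max_lt hv hb))

theorem distInt_le {y : Fin n → ℝ} {c : ℝ} (hc : 0 ≤ c) (p : Fin n → ℤ)
    (h : ∀ i, |y i - p i| ≤ c) : distInt y ≤ c := by
  rw [distInt, pi_norm_le_iff_of_nonneg hc]
  exact fun i => (round_le (y i) (p i)).trans (h i)

theorem simExp_nonneg (x θ : EuclideanSpace ℝ (Fin n)) : 0 ≤ simExp x θ := by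
  refine EReal.coe_le_of_forall_lt (b := 0) fun v hv => le_sSup ⟨v, ?_, rfl⟩
  refine (Set.Ioi_infinite (0 : ℕ)).mono fun q hq => ⟨hq, ?_⟩
  have h1 : (1 : ℝ) ≤ q := by exact_mod_cast hq
  have h2 : distInt (fun i => (q : ℝ) * x i + θ i) ≤ 1 / 2 := by
    rw [distInt, pi_norm_le_iff_of_nonneg (by norm_num)]
    exact fun i => abs_sub_round _
  have h3 : (1 : ℝ) ≤ (q : ℝ) ^ (-v) := Real.one_le_rpow h1 (by linarith)
  linarith

theorem exists_rpow_neg_lt {v v' : ℝ} (hvv : v' < v) (N : ℝ) :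
    ∃ N₀ : ℝ, N ≤ N₀ ∧ 0 < N₀ ∧ ∀ T, N₀ ≤ T → T ^ (-v) < (3 * T) ^ (-v') := by
  obtain ⟨N₀, h⟩ := Filter.eventually_atTop.1
    ((tendsto_rpow_atTop (sub_pos.2 hvv)).eventually_gt_atTop (3 ^ v'))
  refine ⟨max N (max N₀ 1), le_max_left _ _, by positivity, fun T hT => ?_⟩
  have hT0 : 0 < T := lt_of_lt_of_le (by positivity) hT
  have h1 := h T ((le_max_left _ _).trans ((le_max_right _ _).trans hT))
  rw [Real.mul_rpow (by norm_num) hT0.le, Real.rpow_neg (by norm_num) v',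
    inv_mul_eq_div, lt_div_iff₀ (by positivity), show -v' = -v + (v - v') by ring,
    Real.rpow_add hT0]
  gcongr

theorem SimCovering.le_simExp {x : EuclideanSpace ℝ (Fin n)} {v v' : ℝ}
    (hx : SimCovering x v) (hv' : 0 ≤ v') (hvv : v' < v) (θ : EuclideanSpace ℝ (Fin n)) :
    (v' : EReal) ≤ simExp x θ := by
  refine le_sSup ⟨v', Set.infinite_of_forall_exists_gt fun N => ?_, rfl⟩
  obtain ⟨N₀, hN₀, hN₀0, hpow⟩ := exists_rpow_neg_lt hvv (N + 1)
  obtain ⟨T, hT, hcov⟩ := hx N₀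
  have hT0 : 0 < T := hN₀0.trans_le hT
  -- Centring the interval at `T + N + 1` forces `N + 1 ≤ q ≤ 3 T`, so `q` is positive and
  -- arbitrarily large.
  obtain ⟨q, p, hq, hp⟩ := hcov (T + N + 1) (fun i => -θ i)
  rw [abs_le] at hq
  have hqN : (N : ℝ) + 1 ≤ q := by linarith
  have hq3 : (q : ℝ) ≤ 3 * T := by linarith
  have hqN' : (N : ℤ) + 1 ≤ q := by exact_mod_cast hqN
  lift q to ℕ using by omega
  simp only [Int.cast_natCast] at hqN hq3 hp
  refine ⟨q, ⟨by omega, ?_⟩, by omega⟩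
  have hq0 : (0 : ℝ) < q := by linarith [Nat.cast_nonneg (α := ℝ) N]
  calc distInt (fun i => (q : ℝ) * x i + θ i) ≤ T ^ (-v) := by
        refine distInt_le (by positivity) (fun i => -p i) fun i => ?_
        convert hp i using 2
        push_cast
        ring
    _ < (3 * T) ^ (-v') := hpow T hT
    _ ≤ (q : ℝ) ^ (-v') := Real.rpow_le_rpow_of_nonpos hq0 hq3 (by linarith)

theorem DualCovering.le_dualExp (hn : n ≠ 0) {x : EuclideanSpace ℝ (Fin n)} {v v' : ℝ}
    (hx : DualCovering x v) (hv' : 0 ≤ v') (hvv : v' < v) (θ : ℝ) :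
    (v' : EReal) ≤ dualExp x θ := by
  refine le_sSup ⟨v', fun hfin => ?_, rfl⟩
  obtain ⟨B, hB⟩ := (hfin.image fun q => ‖q‖).bddAbove
  set N := max B 0 with hN
  obtain ⟨N₀, hN₀, hN₀0, hpow⟩ := exists_rpow_neg_lt hvv (N + 1)
  obtain ⟨T, hT, hcov⟩ := hx N₀
  have hT0 : 0 < T := hN₀0.trans_le hT
  obtain ⟨u, h, hu, hh⟩ := hcov (fun _ => T + N + 1) θ
  have hN0 : 0 ≤ N := le_max_right _ _
  have hlow : ∀ i, N + 1 ≤ (u i : ℝ) := fun i => by linarith [(abs_le.1 (hu i)).1]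
  have hup : ‖u‖ ≤ 3 * T := by
    rw [pi_norm_le_iff_of_nonneg (by positivity)]
    intro i
    rw [Int.norm_eq_abs, abs_le]
    constructor <;> linarith [hlow i, (abs_le.1 (hu i)).2]
  have hnorm : N + 1 ≤ ‖u‖ := by
    refine ((hlow ⟨0, Nat.pos_of_ne_zero hn⟩).trans (le_abs_self _)).trans ?_
    exact norm_le_pi_norm u _
  have hu0 : 0 < ‖u‖ := by linarith
  have hmem : ‖u‖ ≤ B := hB ⟨u, ⟨norm_pos_iff.1 hu0, ?_⟩, rfl⟩
  · linarith [le_max_left B 0]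
  calc _ ≤ |(∑ i, (u i : ℝ) * x i + θ) - h| := round_le _ _
    _ ≤ T ^ (-v) := by
        rw [abs_sub_comm]
        convert hh using 2
        ring
    _ < (3 * T) ^ (-v') := hpow T hT
    _ ≤ ‖u‖ ^ (-v') := Real.rpow_le_rpow_of_nonpos hu0 hup (by linarith)

theorem Set.Finite.exists_pos_le {α : Type*} {s : Set α} (hs : s.Finite) (f : α → ℝ)
    (hf : ∀ a ∈ s, 0 < f a) : ∃ c : ℝ, 0 < c ∧ c ≤ 1 ∧ ∀ a ∈ s, c ≤ f a := by
  rcases s.eq_empty_or_nonempty with rfl | hne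
  · exact ⟨1, one_pos, le_rfl, by simp⟩
  · obtain ⟨a, ha, hmin⟩ := Set.exists_min_image s f hs hne
    exact ⟨min (f a) 1, lt_min (hf a ha) one_pos, min_le_right _ _,
      fun b hb => (min_le_left _ _).trans (hmin b hb)⟩

/-- Only finitely many `q` violate the bound with constant `1`, and `c` absorbs them. None has `q x`
integral, since all its multiples would then be exceptions too. -/
theorem exists_simLowerBound {x : EuclideanSpace ℝ (Fin n)} {w : ℝ} (hw : simExp x 0 < w) :
    ∃ c, 0 < c ∧ SimLowerBound x c w := by
  set S : Set ℕ := {q : ℕ | 0 < q ∧ distInt (fun i => (q : ℝ) * x i) < (q : ℝ) ^ (-w)} with hS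
  have hfin : S.Finite := by
    by_contra hinf
    have hle : (w : EReal) ≤ simExp x 0 := le_sSup ⟨w, by simpa [hS] using hinf, rfl⟩
    exact absurd hle (not_le.2 hw)
  have hpos : ∀ q : ℕ, 0 < q → 0 < distInt (fun i => (q : ℝ) * x i) := by
    intro q hq
    by_contra hle
    have h0 : distInt (fun i => (q : ℝ) * x i) = 0 := le_antisymm (not_lt.1 hle) (norm_nonneg _)
    rw [distInt, norm_eq_zero] at h0
    refine absurd hfin (Set.infinite_of_forall_exists_gt fun N =>
      ⟨(N + 1) * q, ⟨by positivity, ?_⟩, by nlinarith⟩)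
    refine (distInt_le le_rfl (fun i => (N + 1) * round ((q : ℝ) * x i)) fun i => ?_).trans_lt
      (by positivity)
    have h1 := congrFun h0 i
    simp only [Pi.zero_apply, sub_eq_zero] at h1
    push_cast
    rw [← h1, mul_assoc, sub_self, abs_zero]
  obtain ⟨c, hc, hc1, hcS⟩ := hfin.exists_pos_le
    (fun q => distInt (fun i => (q : ℝ) * x i) / (q : ℝ) ^ (-w))
    (fun q hq => div_pos (hpos q hq.1) (Real.rpow_pos_of_pos (by exact_mod_cast hq.1) _))
  have hnat : ∀ q : ℕ, 0 < q → c * (q : ℝ) ^ (-w) ≤ distInt (fun i => (q : ℝ) * x i) := by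
    intro q hq
    have hq0 : (0 : ℝ) < (q : ℝ) ^ (-w) := Real.rpow_pos_of_pos (by exact_mod_cast hq) _
    by_cases hqS : q ∈ S
    · exact (le_div_iff₀ hq0).1 (hcS q hqS)
    · have h1 : (q : ℝ) ^ (-w) ≤ distInt (fun i => (q : ℝ) * x i) := by
        by_contra hlt
        exact hqS ⟨hq, not_le.1 hlt⟩
      nlinarith
  refine ⟨c, hc, fun q p hq => ?_⟩
  by_contra hall
  push Not at hall
  have habs : ((q.natAbs : ℕ) : ℝ) = |(q : ℝ)| := by
    rw [Nat.cast_natAbs, Int.cast_abs]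
  have h1 := hnat q.natAbs (Int.natAbs_pos.2 hq)
  rw [habs] at h1
  refine absurd h1 (not_le.2 ?_)
  have hqpos : 0 < |(q : ℝ)| := abs_pos.2 (by exact_mod_cast hq)
  rw [distInt, pi_norm_lt_iff (by positivity)]
  intro i
  rcases abs_choice (q : ℝ) with h | h
  · rw [Real.norm_eq_abs]
    refine (round_le _ (-p i)).trans_lt ?_
    refine lt_of_eq_of_lt (congrArg abs ?_) (hall i)
    rw [h]
    push_cast
    ring
  · rw [Real.norm_eq_abs]
    refine (round_le _ (p i)).trans_lt ?_
    rw [← abs_neg]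
    refine lt_of_eq_of_lt (congrArg abs ?_) (hall i)
    rw [h]
    ring

theorem exists_dualLowerBound {x : EuclideanSpace ℝ (Fin n)} {w : ℝ} (hw : dualExp x 0 < w) :
    ∃ c, 0 < c ∧ DualLowerBound x c w := by
  set F : (Fin n → ℤ) → ℝ := fun u => |∑ i, (u i : ℝ) * x i - round (∑ i, (u i : ℝ) * x i)|
    with hF
  set S : Set (Fin n → ℤ) := {u | u ≠ 0 ∧ F u < ‖u‖ ^ (-w)} with hS
  have hfin : S.Finite := by
    by_contra hinf
    have hle : (w : EReal) ≤ dualExp x 0 := le_sSup ⟨w, by simpa [hS, hF] using hinf, rfl⟩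
    exact absurd hle (not_le.2 hw)
  have hpos : ∀ u : Fin n → ℤ, u ≠ 0 → 0 < F u := by
    intro u hu
    by_contra hle
    have h0 : ∑ i, (u i : ℝ) * x i - round (∑ i, (u i : ℝ) * x i) = 0 :=
      abs_eq_zero.1 (le_antisymm (not_lt.1 hle) (abs_nonneg _))
    rw [sub_eq_zero] at h0
    have hinj : Function.Injective fun k : ℕ => ((k : ℤ) + 1) • u := by
      intro k l hkl
      have h1 : (k : ℤ) + 1 = l + 1 := smul_left_injective ℤ hu hkl
      omega
    refine absurd hfin ((Set.infinite_range_of_injective hinj).mono ?_)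
    rintro _ ⟨k, rfl⟩
    have hne : ((k : ℤ) + 1) • u ≠ 0 := smul_ne_zero (by omega) hu
    refine ⟨hne, ?_⟩
    have hsum : ∑ i, (((((k : ℤ) + 1) • u) i : ℤ) : ℝ) * x i
        = ((((k : ℤ) + 1) * round (∑ i, (u i : ℝ) * x i) : ℤ) : ℝ) := by
      rw [Int.cast_mul, ← h0, Finset.mul_sum]
      refine Finset.sum_congr rfl fun i _ => ?_
      simp [mul_assoc]
    simp only [hF]
    rw [hsum, round_intCast, sub_self, abs_zero]
    exact Real.rpow_pos_of_pos (norm_pos_iff.2 hne) _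
  obtain ⟨c, hc, hc1, hcS⟩ := hfin.exists_pos_le (fun u => F u / ‖u‖ ^ (-w))
    (fun u hu => div_pos (hpos u hu.1) (Real.rpow_pos_of_pos (norm_pos_iff.2 hu.1) _))
  refine ⟨c, hc, fun u h hu => ?_⟩
  have hu0 : 0 < ‖u‖ ^ (-w) := Real.rpow_pos_of_pos (norm_pos_iff.2 hu) _
  have hFu : c * ‖u‖ ^ (-w) ≤ F u := by
    by_cases huS : u ∈ S
    · exact (le_div_iff₀ hu0).1 (hcS u huS)
    · have h1 : ‖u‖ ^ (-w) ≤ F u := by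
        by_contra hlt
        exact huS ⟨hu, not_le.1 hlt⟩
      nlinarith
  rw [abs_sub_comm]
  exact hFu.trans (round_le _ h)

end Exponents

/-! ### Almost everywhere statements and conclusion -/

/-- Each rational level above the supremum has a null superlevel set, and countably many such levels
suffice. -/
theorem ae_le_sSup_of_measure_pos {α : Type*} [MeasurableSpace α] (μ : Measure α)
    (f : α → EReal) :
    ∀ᵐ x ∂μ, f x ≤
      sSup ((fun v : ℝ => (v : EReal)) '' {v : ℝ | 0 < μ {x | (v : EReal) < f x}}) := by
  set W := sSup ((fun v : ℝ => (v : EReal)) '' {v : ℝ | 0 < μ {x | (v : EReal) < f x}}) with hW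
  have h1 : ∀ᵐ x ∂μ, ∀ q : ℚ, W < ((q : ℝ) : EReal) → f x ≤ ((q : ℝ) : EReal) := by
    rw [ae_all_iff]
    intro q
    by_cases hq : W < ((q : ℝ) : EReal)
    · have h0 : μ {x | ((q : ℝ) : EReal) < f x} = 0 := by
        by_contra hne
        have hle : ((q : ℝ) : EReal) ≤ W := le_sSup ⟨q, pos_iff_ne_zero.2 hne, rfl⟩
        exact absurd hle (not_le.2 hq)
      have h2 : ∀ᵐ x ∂μ, ¬((q : ℝ) : EReal) < f x := by
        rw [ae_iff]
        simpa using h0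
      filter_upwards [h2] with x hx _ using not_lt.1 hx
    · exact Filter.Eventually.of_forall fun x hx => absurd hx hq
  filter_upwards [h1] with x hx
  by_contra hlt
  obtain ⟨q, hq1, hq2⟩ := EReal.lt_iff_exists_rat_btwn.1 (not_le.1 hlt)
  exact absurd (hx q hq1) (not_le.2 hq2)

theorem ae_exists_mul_add_ne_zero {n d : ℕ} (hd : 1 ≤ d) (M : Set (EuclideanSpace ℝ (Fin n))) :
    ∀ᵐ x ∂(submanifoldMeasure d M),
      ∀ (q : ℤ) (p : Fin n → ℤ), q ≠ 0 → ∃ i, (q : ℝ) * x i + p i ≠ 0 := by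
  refine ae_restrict_of_ae ?_
  have : NullSingletonClass (Measure.hausdorffMeasure (d : ℝ) : Measure (EuclideanSpace ℝ (Fin n))) :=
    Measure.nullSingletonClass_hausdorff _ (by exact_mod_cast hd)
  rw [ae_iff]
  refine ((Set.countable_range fun a : ℤ × (Fin n → ℤ) =>
    (WithLp.toLp 2 fun i => -(a.2 i : ℝ) / a.1 : EuclideanSpace ℝ (Fin n))).mono ?_).measure_zero _
  intro x hx
  simp only [Set.mem_ofPred_eq, not_forall, not_exists, not_not] at hx
  obtain ⟨q, p, hq, h⟩ := hx
  refine ⟨(q, p), ?_⟩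
  ext i
  have hq' : (q : ℝ) ≠ 0 := by exact_mod_cast hq
  rw [PiLp.toLp_apply, div_eq_iff hq']
  linarith [h i]

theorem le_simExp_of_simExp_le {n : ℕ} (hn : n ≠ 0) {x : EuclideanSpace ℝ (Fin n)}
    (hind : ∀ (q : ℤ) (p : Fin n → ℤ), q ≠ 0 → ∃ i, (q : ℝ) * x i + p i ≠ 0) {W : EReal}
    (hW : simExp x 0 ≤ W) (θ : EuclideanSpace ℝ (Fin n)) :
    max 0 (1 - (((n : ℝ) - 1 : ℝ) : EReal) * W) ≤ simExp x θ := by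
  refine max_le (simExp_nonneg x θ) ?_
  rcases (show n = 1 ∨ 2 ≤ n by omega) with rfl | hn2
  · have h1 : ((1 : ℝ) : EReal) ≤ simExp x θ := by
      refine EReal.coe_le_of_forall_nonneg_lt one_pos fun v hv0 hv => ?_
      obtain ⟨v', h1, h2⟩ := exists_between hv
      exact (simCovering_one_of_irrational x hind h2).le_simExp hv0 h1 θ
    simpa using h1
  have hn2' : (2 : ℝ) ≤ n := by exact_mod_cast hn2
  have hlow : ∀ w : ℝ, W < w → ∃ c, 0 < c ∧ SimLowerBound x c w := fun w hw =>
    exists_simLowerBound (hW.trans_lt hw)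
  induction W using EReal.rec with
  | bot =>
    obtain ⟨c, hc, hx⟩ := hlow 0 (EReal.bot_lt_coe 0)
    have h1 := one_div_le_of_simLowerBound hn x hc hx
    have h2 : (0 : ℝ) < 1 / n := by positivity
    linarith
  | top =>
    rw [EReal.coe_mul_top_of_pos (by linarith)]
    exact bot_le
  | coe W =>
    have h1 : ((1 - (n - 1) * W : ℝ) : EReal) ≤ simExp x θ := by
      refine EReal.coe_le_of_forall_lt fun v hv => ?_
      rcases lt_or_ge v 0 with hv0 | hv0
      · exact le_trans (by exact_mod_cast hv0.le) (simExp_nonneg x θ)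
      have hn1 : (0 : ℝ) < n - 1 := by linarith
      set ε := (1 - (n - 1) * W - v) / (2 * (n - 1)) with hε
      have hε0 : 0 < ε := div_pos (by linarith) (by linarith)
      have hεmul : (n - 1) * ε = (1 - (n - 1) * W - v) / 2 := by
        rw [hε]
        field_simp
      have hvw : v < 1 - (n - 1) * (W + ε) := by linarith
      obtain ⟨c, hc, hx⟩ := hlow (W + ε) (by exact_mod_cast lt_add_of_pos_right W hε0)
      obtain ⟨v', hv1, hv2⟩ := exists_between hvw
      refine (simCovering_of_lowerBound hn2 x hc (one_div_le_of_simLowerBound hn x hc hx) hx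
        (fun u h hu huh => ?_) hv2).le_simExp hv0 hv1 θ
      -- A relation would give `1 - (n - 1) (W + ε) ≤ 0`, against `0 ≤ v`.
      have := one_le_mul_of_simLowerBound x hc hx u h hu huh
      linarith
    exact_mod_cast h1

theorem le_dualExp_of_dualExp_le {n : ℕ} (hn : n ≠ 0) {x : EuclideanSpace ℝ (Fin n)}
    (hind : ∀ (q : ℤ) (p : Fin n → ℤ), q ≠ 0 → ∃ i, (q : ℝ) * x i + p i ≠ 0) {W : EReal}
    (hW : dualExp x 0 ≤ W) (θ : ℝ) :
    (W ≠ ⊤ → W / (W - (n : EReal) + 1) ≤ dualExp x θ) ∧ (W = ⊤ → 1 ≤ dualExp x θ) := by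
  have hone : ∀ v : ℝ, 0 ≤ v → v < 1 → (v : EReal) ≤ dualExp x θ := by
    intro v hv0 hv
    obtain ⟨v', h1, h2⟩ := exists_between hv
    exact (dualCovering_of_irrational hn x hind h2).le_dualExp hn hv0 h1 θ
  refine ⟨fun htop => ?_, fun _ => EReal.coe_le_of_forall_nonneg_lt one_pos hone⟩
  have hlow : ∀ w : ℝ, W < w → ∃ c, 0 < c ∧ DualLowerBound x c w := fun w hw =>
    exists_dualLowerBound (hW.trans_lt hw)
  have hn1 : (1 : ℝ) ≤ n := by exact_mod_cast Nat.pos_of_ne_zero hn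
  induction W using EReal.rec with
  | bot =>
    obtain ⟨c, hc, hx⟩ := hlow 0 (EReal.bot_lt_coe 0)
    have h1 := le_of_dualLowerBound hn x hc hx
    linarith
  | top => exact absurd rfl htop
  | coe W =>
    have hnW : (n : ℝ) ≤ W := by
      refine le_of_forall_gt_imp_ge_of_dense fun w hw => ?_
      obtain ⟨c, hc, hx⟩ := hlow w (by exact_mod_cast hw)
      exact le_of_dualLowerBound hn x hc hx
    have hden : 0 < W - n + 1 := by linarith
    have h1 : ((W / (W - n + 1) : ℝ) : EReal) ≤ dualExp x θ := by
      refine EReal.coe_le_of_forall_nonneg_lt (div_pos (by linarith) hden) fun v hv0 hv => ?_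
      rcases lt_or_ge v 1 with hv1 | hv1
      · exact hone v hv0 hv1
      rw [lt_div_iff₀ hden] at hv
      have hn2 : 2 ≤ n := by
        by_contra hlt
        have : n = 1 := by omega
        subst this
        push_cast at hv
        nlinarith
      set ε := (W - v * (W - n + 1)) / (2 * v) with hε
      have hε0 : 0 < ε := div_pos (by linarith) (by linarith)
      have hεmul : v * ε = (W - v * (W - n + 1)) / 2 := by
        rw [hε]
        field_simp
      have hvw : v < (W + ε) / (W + ε - n + 1) := by
        rw [lt_div_iff₀ (by linarith)]
        nlinarith
      obtain ⟨c, hc, hx⟩ := hlow (W + ε) (by exact_mod_cast lt_add_of_pos_right W hε0)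
      obtain ⟨v', h1, h2⟩ := exists_between hvw
      exact (dualCovering_of_lowerBound hn2 x hc (le_of_dualLowerBound hn x hc hx) hx hind
        h2).le_dualExp hn hv0 h1 θ
    exact_mod_cast h1

theorem mainTheorem4 (n d : ℕ) (hd : 1 ≤ d) (M : Set (EuclideanSpace ℝ (Fin n)))
    (hM : IsDiffSubmanifold d M) :
    (∀ᵐ x ∂(submanifoldMeasure d M), ∀ θ : EuclideanSpace ℝ (Fin n),
      max 0 (1 - (((n : ℝ) - 1 : ℝ) : EReal) * simExpManifold d M) ≤ simExp x θ) ∧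
    (∀ᵐ x ∂(submanifoldMeasure d M), ∀ θ : ℝ,
      (dualExpManifold d M ≠ ⊤ →
        dualExpManifold d M / (dualExpManifold d M - (n : EReal) + 1) ≤ dualExp x θ) ∧
      (dualExpManifold d M = ⊤ → 1 ≤ dualExp x θ)) := by
  have hind := ae_exists_mul_add_ne_zero hd M
  -- In dimension `0` no point is non-rational, so the almost everywhere condition itself supplies
  -- `n ≠ 0`.
  have hn : (∀ (q : ℤ) (p : Fin n → ℤ), q ≠ 0 → ∃ i : Fin n, True) → n ≠ 0 := by
    intro h
    obtain ⟨i, -⟩ := h 1 0 one_ne_zero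
    exact i.pos.ne'
  constructor
  · filter_upwards [hind, ae_le_sSup_of_measure_pos (submanifoldMeasure d M) (simExp · 0)]
      with x hx hle θ
    exact le_simExp_of_simExp_le (hn fun q p hq => (hx q p hq).imp fun _ _ => trivial) hx hle θ
  · filter_upwards [hind, ae_le_sSup_of_measure_pos (submanifoldMeasure d M) (dualExp · 0)]
      with x hx hle θ
    exact le_dualExp_of_dualExp_le (hn fun q p hq => (hx q p hq).imp fun _ _ => trivial) hx hle θ
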